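/- Let $\mathbb{R}_+$ be the poset $[0,\infty)$. A persistent object in a category $\mathcal C$ is a functor $\mathbb{X}:\mathbb{R}_+\to\mathcal C$. It is \emph{tame} if there are finitely many $t_0<\dots<t_n$ in $[0,\infty)$ such that a structure map $\mathbb{X}(a)\to\mathbb{X}(b)$, $a<b$, can fail to be an isomorphism only if $a<t_i\le b$ for some $i$. A persistent cochain complex is a persistent object in non-negatively graded cochain complexes over $\mathbb{Q}$; $\mathbb{X}^k$ and $Z\mathbb{X}^k$ denote its persistence modules of $k$-cochains and $k$-cocycles. For $0\le s<t\le\infty$ let $\mathbb{I}_{[s,t)}$ be the interval module, equal to $\mathbb{Q}$ on $[s,t)$ with identity structure maps and $0$ elsewhere. Let $S^k$ be the complex $\mathbb{Q}$ in degree $k$, and $D^k$ the complex $\mathbb{Q}\xrightarrow{=}\mathbb{Q}$ in degrees $k-1,k$, with $D^0=0$. For $k\ge 0$ the persistent disk $\mathbb{D}^k_s$ is $D^k$ at times $\ge s$ and $0$ before; the interval sphere $\mathbb{S}^k_{[s,t)}$ is $0$ before $s$, $S^k$ on $[s,t)$ and $D^k$ from $t$ on; the structure maps are the natural ones, and there is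 a natural map $\mathbb{S}^k_{[s,t)}\to\mathbb{D}^k_s$. The \emph{interval-sphere model structure} on persistent cochain complexes has the pointwise quasi-isomorphisms as weak equivalences, generating cofibrations $\mathbb{S}^k_{[s,t)}\to\mathbb{D}^k_s$ ($k\ge0$, $0\le s<t\le\infty$), and generating trivial cofibrations $\mathbb{D}^k_t\to\mathbb{D}^k_s$ and $0\to\mathbb{D}^k_s$ ($k\ge0$, $0\le s<t<\infty$). Thus its cofibrations are the maps with the left lifting property against every map that has the right lifting property against the generating cofibrations. \textbf{Statement.} Let $i:\mathbb{X}\to\mathbb{Y}$ be a (pointwise, degreewise) injective map of tame persistent cochain complexes. Then $i$ is a cofibration in the interval-sphere model structure. Moreover, let $\mathbb{W}=i(\mathbb{X})+Z\mathbb{Y}\subseteq\mathbb{Y}$. Then $i$ is the composite $\mathbb{X}\to\mathbb{W}\hookrightarrow\mathbb{Y}$ of two cell attachments, as follows. (1) For each $k\ge0$ there are a set $\Gamma_k$, intervals $[s_\gamma,t_\gamma)$ with $0\le s_\gamma<t_\gamma\le\infty$, and cocycles $z_\gamma\in Z\mathbb{Y}^k(s_\gamma)$, $\gamma\in\Gamma_k$,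 whose classes are the generators of the summands in an interval decomposition $Z\mathbb{Y}^k/i(Z\mathbb{X}^k)\cong\bigoplus_{\gamma\in\Gamma_k}\mathbb{I}_{[s_\gamma,t_\gamma)}$; and there is a pushout square $$\begin{array}{ccc}\bigoplus_{k}\bigoplus_{\gamma\in\Gamma_k}\mathbb{S}^{k+1}_{[s_\gamma,t_\gamma)}&\to&\mathbb{X}\\ \downarrow&&\downarrow\\ \bigoplus_{k}\bigoplus_{\gamma\in\Gamma_k}\mathbb{D}^{k+1}_{s_\gamma}&\to&\mathbb{W}\end{array}$$ whose left map is the sum of the natural maps, whose right map is induced by $i$, and whose bottom map sends the degree $k$ generator of the summand $\gamma$ (at time $s_\gamma$) to $z_\gamma$. (2) For each $k\ge0$ there are a set $\Delta_k$, intervals $[s_\delta,t_\delta)$ with $0\le s_\delta<t_\delta\le\infty$, and elements $y_\delta\in\mathbb{Y}^k(s_\delta)$, $\delta\in\Delta_k$, whose classes are the generators of the summands in an interval decomposition $\mathbb{Y}^k/\mathbb{W}^k\cong\bigoplus_{\delta\in\Delta_k}\mathbb{I}_{[s_\delta,t_\delta)}$; and there is a pushout square as in (1), with $\Delta_k$,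 $\mathbb{W}\hookrightarrow\mathbb{Y}$ and $y_\delta$ in place of $\Gamma_k$, $\mathbb{X}\to\mathbb{W}$ and $z_\gamma$. In particular, every tame persistent cochain complex is cofibrant in the interval-sphere model structure. (All this holds in particular for tame connected objects.) -/

import Mathlib

open CategoryTheory CategoryTheory.Limits HomotopicalAlgebra
open scoped NNReal

noncomputable section

namespace PersistentComplex

/-- Persistent objects in `C`: functors from the poset `[0, ∞)` to `C`. -/
abbrev Persistent (C : Type*) [Category* C] := ℝ≥0 ⥤ C

/-- Persistence modules over `ℚ`. -/
abbrev PVec := Persistent (ModuleCat.{0} ℚ)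

/-- Persistent (non-negatively graded) cochain complexes over `ℚ`. -/
abbrev PCh := Persistent (CochainComplex (ModuleCat.{0} ℚ) ℕ)

/-! ### Tameness and injectivity -/

/-- The sequence `t 0 < ⋯ < t n` discretizes `X`: a structure map `X(a < b)` may fail to be an
isomorphism only if `a < t i ≤ b` for some `i`. -/
def Discretizes {C : Type*} [Category* C] (X : Persistent C) {n : ℕ} (t : Fin (n + 1) → ℝ≥0) :
    Prop :=
  ∀ (a b : ℝ≥0) (h : a < b), ¬ IsIso (X.map (homOfLE h.le)) → ∃ i, a < t i ∧ t i ≤ b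

/-- A persistent object is tame if it admits a discretization. -/
def IsTame {C : Type*} [Category* C] (X : Persistent C) : Prop :=
  ∃ (n : ℕ) (t : Fin (n + 1) → ℝ≥0), StrictMono t ∧ Discretizes X t

/-- Injective maps of persistent complexes: injective at every time, in every degree. -/
def IsInjective {X Y : PCh} (i : X ⟶ Y) : Prop :=
  ∀ (r : ℝ≥0) (k : ℕ), Function.Injective ((i.app r).f k)

/-! ### Copies of `ℚ` supported on a proposition -/

/-- The vector space which is `ℚ` if `P` holds, and `0` otherwise. -/
abbrev QIf (P : Prop) : ModuleCat.{0} ℚ := ModuleCat.of ℚ (PLift P → ℚ)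

/-- The generator `1` of `QIf P` (which is `0` if `P` fails). -/
def QIf.one (P : Prop) : QIf P := (fun _ => 1 : PLift P → ℚ)

open Classical in
/-- The linear map underlying `QIf.map`. -/
def QIf.linearMap (P Q : Prop) : (PLift P → ℚ) →ₗ[ℚ] (PLift Q → ℚ) where
  toFun f _ := if h : P then f ⟨h⟩ else 0
  map_add' f g := by funext q; by_cases h : P <;> simp [h]
  map_smul' c f := by funext q; by_cases h : P <;> simp [h]

/-- The map `QIf P ⟶ QIf Q` which is the identity of `ℚ` if `P` and `Q` hold, and `0`
otherwise. -/
def QIf.map (P Q : Prop) : QIf P ⟶ QIf Q := ModuleCat.ofHom (QIf.linearMap P Q)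

theorem QIf.linearMap_of {P : Prop} (Q : Prop) (h : P) (f : PLift P → ℚ) (q : PLift Q) :
    QIf.linearMap P Q f q = f ⟨h⟩ := dif_pos h

theorem QIf.linearMap_of_not {P : Prop} (Q : Prop) (h : ¬ P) (f : PLift P → ℚ) (q : PLift Q) :
    QIf.linearMap P Q f q = 0 := dif_neg h

theorem QIf.map_self (P : Prop) : QIf.map P P = 𝟙 (QIf P) := by
  apply ModuleCat.hom_ext
  apply LinearMap.ext
  intro f
  funext q
  exact QIf.linearMap_of P q.down f q

theorem QIf.map_comp (P Q R : Prop) (h : P → R → Q) :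
    QIf.map P Q ≫ QIf.map Q R = QIf.map P R := by
  apply ModuleCat.hom_ext
  apply LinearMap.ext
  intro f
  funext r
  change QIf.linearMap Q R (QIf.linearMap P Q f) r = QIf.linearMap P R f r
  by_cases hP : P
  · rw [QIf.linearMap_of R (h hP r.down), QIf.linearMap_of Q hP, QIf.linearMap_of R hP]
  · rw [QIf.linearMap_of_not R hP]
    by_cases hQ : Q
    · rw [QIf.linearMap_of R hQ, QIf.linearMap_of_not Q hP]
    · rw [QIf.linearMap_of_not R hQ]

theorem QIf.map_eq_zero (P Q : Prop) (h : P → ¬ Q) : QIf.map P Q = 0 := by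
  apply ModuleCat.hom_ext
  apply LinearMap.ext
  intro f
  funext q
  exact QIf.linearMap_of_not Q (fun hP => h hP q.down) f q

theorem QIf.comp_eq_zero (P Q R : Prop) (h : P → ¬ R) :
    QIf.map P Q ≫ QIf.map Q R = 0 := by
  by_cases hQ : P → ¬ Q
  · rw [QIf.map_eq_zero P Q hQ, zero_comp]
  · rw [QIf.map_comp P Q R (fun hP hR => absurd hR (h hP)), QIf.map_eq_zero P R h]

/-! ### Interval modules, interval spheres and persistent disks -/

/-- The interval module of `[s, t)`, where `t` may be `⊤`. -/
def intervalModule (s : ℝ≥0) (t : WithTop ℝ≥0) : PVec where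
  obj r := QIf (s ≤ r ∧ (r : WithTop ℝ≥0) < t)
  map _ := QIf.map _ _
  map_id _ := QIf.map_self _
  map_comp {_ _ _} f g := (QIf.map_comp _ _ _ fun h h' =>
    ⟨h.1.trans (leOfHom f), lt_of_le_of_lt (WithTop.coe_le_coe.2 (leOfHom g)) h'.2⟩).symm

/-- The generator of the interval module of `[s, t)`, at time `s`. -/
def intervalModule.gen (s : ℝ≥0) (t : WithTop ℝ≥0) : (intervalModule s t).obj s := QIf.one _

/-- A persistent complex consisting of copies of `ℚ` at those times `r` and degrees `j` for which
`P r j` holds, all differentials and structure maps between them being identities. The hypotheses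
are what is needed for this to be a persistent complex. -/
def ofSupport (P : ℝ≥0 → ℕ → Prop)
    (hd : ∀ r j, P r j → ¬ P r (j + 1 + 1))
    (hP : ∀ j r₁ r₂ r₃, r₁ ≤ r₂ → r₂ ≤ r₃ → P r₁ j → P r₃ j → P r₂ j)
    (hc : ∀ j r₁ r₂, r₁ ≤ r₂ → P r₁ j → P r₂ (j + 1) → (P r₂ j ↔ P r₁ (j + 1))) : PCh where
  obj r :=
    { X := fun j => QIf (P r j)
      d := fun i j => if i + 1 = j then QIf.map (P r i) (P r j) else 0
      shape := fun i j h => if_neg h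
      d_comp_d' := by
        rintro i _ _ rfl rfl
        simp only [if_true]
        exact QIf.comp_eq_zero _ _ _ (hd r i) }
  map {r r'} φ :=
    { f := fun j => QIf.map (P r j) (P r' j)
      comm' := by
        rintro i _ rfl
        simp only [if_true]
        by_cases h : P r i ∧ P r' (i + 1)
        · have := hc i r r' (leOfHom φ) h.1 h.2
          by_cases h' : P r' i
          · rw [QIf.map_comp _ _ _ fun _ _ => h', QIf.map_comp _ _ _ fun _ _ => this.1 h']
          · rw [QIf.map_eq_zero (P r i) (P r' i) fun _ => h', zero_comp,
              QIf.map_eq_zero (P r i) (P r (i + 1)) fun _ h'' => h' (this.2 h''), zero_comp]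
        · rw [QIf.comp_eq_zero _ _ _ fun a b => h ⟨a, b⟩,
            QIf.comp_eq_zero _ _ _ fun a b => h ⟨a, b⟩] }
  map_id r := by
    ext1 j
    exact QIf.map_self _
  map_comp {r₁ r₂ r₃} f g := by
    ext1 j
    exact (QIf.map_comp _ _ _ (hP j r₁ r₂ r₃ (leOfHom f) (leOfHom g))).symm

/-- The support of the interval sphere of degree `k` on `[s, t)`: it is the sphere complex `S^k`
at times `s ≤ r < t` and the disk complex `D^k` (a copy of `ℚ` in degrees `k - 1` and `k`) at
times `r ≥ t`, where `D^0 = 0`. -/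
def sphereSupport (k : ℕ) (s : ℝ≥0) (t : WithTop ℝ≥0) (r : ℝ≥0) (j : ℕ) : Prop :=
  s ≤ r ∧ (((r : WithTop ℝ≥0) < t ∧ j = k) ∨
    (t ≤ (r : WithTop ℝ≥0) ∧ k ≠ 0 ∧ (j = k ∨ j + 1 = k)))

/-- The support of the persistent disk of degree `k` at `s`: it is `0` at times `r < s` and
`D^k` at times `r ≥ s`. -/
def diskSupport (k : ℕ) (s : ℝ≥0) (r : ℝ≥0) (j : ℕ) : Prop :=
  s ≤ r ∧ k ≠ 0 ∧ (j = k ∨ j + 1 = k)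

/-- The interval sphere of degree `k` on `[s, t)`: the left Kan extension of `S^k ↪ D^k` along
`{s < t} ⊆ [0, ∞)`. It is meant for `s ≤ t`, where `t` may be `⊤`. -/
def intervalSphere (k : ℕ) (s : ℝ≥0) (t : WithTop ℝ≥0) : PCh :=
  ofSupport (sphereSupport k s t)
    (by
      rintro r j ⟨-, ⟨-, h⟩ | ⟨-, -, h⟩⟩ ⟨-, ⟨-, h'⟩ | ⟨-, -, h'⟩⟩ <;> omega)
    (by
      rintro j r₁ r₂ r₃ h₁₂ h₂₃ ⟨hs, h⟩ ⟨-, h'⟩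
      refine ⟨hs.trans h₁₂, ?_⟩
      by_cases ht : (r₂ : WithTop ℝ≥0) < t
      · have : (r₁ : WithTop ℝ≥0) < t := lt_of_le_of_lt (WithTop.coe_le_coe.2 h₁₂) ht
        exact Or.inl ⟨ht, h.elim (fun a => a.2) fun a => absurd this (not_lt.2 a.1)⟩
      · have : ¬ (r₃ : WithTop ℝ≥0) < t := fun a =>
          ht (lt_of_le_of_lt (WithTop.coe_le_coe.2 h₂₃) a)
        exact Or.inr ⟨not_lt.1 ht, h'.elim (fun a => absurd a.1 this) fun a => a.2⟩)
    (by
      rintro j r₁ r₂ h₁₂ ⟨hs, h⟩ ⟨-, h'⟩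
      have hmono : t ≤ (r₁ : WithTop ℝ≥0) → t ≤ (r₂ : WithTop ℝ≥0) := fun a =>
        a.trans (WithTop.coe_le_coe.2 h₁₂)
      rcases h with ⟨h1, h2⟩ | ⟨h1, h2, h3⟩
      · rcases h' with ⟨h4, h5⟩ | ⟨h4, h5, h6⟩ <;> omega
      · have hk : j + 1 = k := by rcases h' with ⟨h4, h5⟩ | ⟨h4, h5, h6⟩ <;> omega
        exact iff_of_true ⟨hs.trans h₁₂, Or.inr ⟨hmono h1, h2, Or.inr hk⟩⟩
          ⟨hs, Or.inr ⟨h1, h2, Or.inl hk⟩⟩)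

/-- The persistent disk of degree `k` at `s`: the left Kan extension of `D^k` along
`{s} ⊆ [0, ∞)`. It vanishes for `k = 0`. -/
def persistentDisk (k : ℕ) (s : ℝ≥0) : PCh :=
  ofSupport (diskSupport k s)
    (by
      rintro r j ⟨-, -, h⟩ ⟨-, -, h'⟩
      omega)
    (by
      rintro j r₁ r₂ r₃ h₁₂ - ⟨hs, h⟩ -
      exact ⟨hs.trans h₁₂, h⟩)
    (by
      rintro j r₁ r₂ h₁₂ ⟨hs, hk, h⟩ ⟨-, -, h'⟩
      have hk' : j + 1 = k := by omega
      exact iff_of_true ⟨hs.trans h₁₂, hk, Or.inr hk'⟩ ⟨hs, hk, Or.inl hk'⟩)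

/-- The generator of the persistent disk `D_s^{k + 1}`: the element `1` of degree `k` at time
`s`. -/
def persistentDisk.gen (k : ℕ) (s : ℝ≥0) : ((persistentDisk (k + 1) s).obj s).X k := QIf.one _

/-- The natural map from the interval sphere of degree `k` on `[s, t)` to the persistent disk of
degree `k` at `s`: the identity of `ℚ` wherever both are nonzero. -/
def sphereToDisk (k : ℕ) (s : ℝ≥0) (t : WithTop ℝ≥0) :
    intervalSphere k s t ⟶ persistentDisk k s where
  app r :=
    { f := fun j => QIf.map (sphereSupport k s t r j) (diskSupport k s r j)
      comm' := by
        rintro i _ rfl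
        change QIf.map (sphereSupport k s t r i) (diskSupport k s r i) ≫
            (if i + 1 = i + 1 then QIf.map _ _ else 0) =
          (if i + 1 = i + 1 then QIf.map _ _ else 0) ≫
            QIf.map (sphereSupport k s t r (i + 1)) (diskSupport k s r (i + 1))
        rw [if_pos rfl, if_pos rfl]
        by_cases h : sphereSupport k s t r i ∧ diskSupport k s r (i + 1)
        · obtain ⟨⟨hs, h1⟩, -, hk, h2⟩ := h
          have hi : i + 1 = k := by rcases h1 with ⟨a, b⟩ | ⟨a, b, c⟩ <;> omega
          have ht : t ≤ (r : WithTop ℝ≥0) := by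
            rcases h1 with ⟨a, b⟩ | ⟨a, b, c⟩
            · omega
            · exact a
          rw [QIf.map_comp _ _ _ fun _ _ => ⟨hs, hk, Or.inr hi⟩,
            QIf.map_comp _ _ _ fun _ _ => ⟨hs, Or.inr ⟨ht, hk, Or.inl hi⟩⟩]
        · rw [QIf.comp_eq_zero _ _ _ fun a b => h ⟨a, b⟩,
            QIf.comp_eq_zero _ _ _ fun a b => h ⟨a, b⟩] }
  naturality r r' φ := by
    ext1 j
    change QIf.map (sphereSupport k s t r j) (sphereSupport k s t r' j) ≫
        QIf.map (sphereSupport k s t r' j) (diskSupport k s r' j) =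
      QIf.map (sphereSupport k s t r j) (diskSupport k s r j) ≫
        QIf.map (diskSupport k s r j) (diskSupport k s r' j)
    have hr := leOfHom φ
    rw [QIf.map_comp _ _ _ ?_, QIf.map_comp _ _ _ ?_]
    · rintro ⟨hs, -⟩ ⟨-, h⟩
      exact ⟨hs, h⟩
    · rintro ⟨hs, h⟩ ⟨-, hk, h'⟩
      refine ⟨hs.trans hr, ?_⟩
      by_cases ht : (r' : WithTop ℝ≥0) < t
      · have : (r : WithTop ℝ≥0) < t := lt_of_le_of_lt (WithTop.coe_le_coe.2 hr) ht
        exact Or.inl ⟨ht, h.elim (fun a => a.2) fun a => absurd this (not_lt.2 a.1)⟩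
      · exact Or.inr ⟨not_lt.1 ht, hk, h'⟩

/-- The natural map `D_t^k ⟶ D_s^k` for `s ≤ t`. -/
def diskToDisk (k : ℕ) {s t : ℝ≥0} (hst : s ≤ t) : persistentDisk k t ⟶ persistentDisk k s where
  app r :=
    { f := fun j => QIf.map (diskSupport k t r j) (diskSupport k s r j)
      comm' := by
        rintro i _ rfl
        change QIf.map (diskSupport k t r i) (diskSupport k s r i) ≫
            (if i + 1 = i + 1 then QIf.map _ _ else 0) =
          (if i + 1 = i + 1 then QIf.map _ _ else 0) ≫
            QIf.map (diskSupport k t r (i + 1)) (diskSupport k s r (i + 1))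
        rw [if_pos rfl, if_pos rfl, QIf.map_comp _ _ _ ?_, QIf.map_comp _ _ _ ?_]
        · rintro ⟨ht, hk, -⟩ ⟨-, -, h⟩
          exact ⟨ht, hk, h⟩
        · rintro ⟨ht, hk, h⟩ -
          exact ⟨hst.trans ht, hk, h⟩ }
  naturality r r' φ := by
    ext1 j
    change QIf.map (diskSupport k t r j) (diskSupport k t r' j) ≫
        QIf.map (diskSupport k t r' j) (diskSupport k s r' j) =
      QIf.map (diskSupport k t r j) (diskSupport k s r j) ≫
        QIf.map (diskSupport k s r j) (diskSupport k s r' j)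
    rw [QIf.map_comp _ _ _ ?_, QIf.map_comp _ _ _ ?_]
    · rintro ⟨ht, h⟩ -
      exact ⟨hst.trans ht, h⟩
    · rintro ⟨ht, h⟩ -
      exact ⟨ht.trans (leOfHom φ), h⟩

/-! ### The interval-sphere model structure -/

/-- The generating cofibrations: the maps from the interval sphere on `[s, t)` to the persistent
disk at `s`, for `0 ≤ s < t ≤ ∞` and all degrees `k ≥ 0`. -/
inductive generatingCofibrations : MorphismProperty PCh
  | sphereToDisk (k : ℕ) (s : ℝ≥0) (t : WithTop ℝ≥0) (h : (s : WithTop ℝ≥0) < t) :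
      generatingCofibrations (sphereToDisk k s t)

/-- The generating trivial cofibrations: the maps `D_t^k ⟶ D_s^k` for `0 ≤ s < t < ∞`, and the
maps `0 ⟶ D_s^k` for `0 ≤ s < ∞`, for all degrees `k ≥ 0`. -/
inductive generatingTrivialCofibrations : MorphismProperty PCh
  | diskToDisk (k : ℕ) (s t : ℝ≥0) (h : s < t) :
      generatingTrivialCofibrations (diskToDisk k h.le)
  | zeroToDisk (k : ℕ) (s : ℝ≥0) :
      generatingTrivialCofibrations (initial.to (persistentDisk k s))

/-- The cofibrations of the interval-sphere model structure: the maps with the left lifting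
property against all maps that have the right lifting property against the generating
cofibrations. -/
instance : CategoryWithCofibrations PCh where
  cofibrations := generatingCofibrations.rlp.llp

/-- The fibrations of the interval-sphere model structure: the maps with the right lifting
property against the generating trivial cofibrations. -/
instance : CategoryWithFibrations PCh where
  fibrations := generatingTrivialCofibrations.rlp

/-- The weak equivalences of the interval-sphere model structure: the pointwise
quasi-isomorphisms. -/
instance : CategoryWithWeakEquivalences PCh where
  weakEquivalences := fun _ _ f => ∀ r : ℝ≥0, QuasiIso (f.app r)

/-! ### Interval decompositions and cell attachments -/

/-- The persistence module of `k`-cochains. -/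
abbrev cochains (k : ℕ) : PCh ⥤ PVec :=
  (Functor.whiskeringRight _ _ _).obj (HomologicalComplex.eval (ModuleCat.{0} ℚ) _ k)

/-- The persistence module of `k`-cocycles. -/
abbrev cocycles (k : ℕ) : PCh ⥤ PVec :=
  (Functor.whiskeringRight _ _ _).obj (HomologicalComplex.cyclesFunctor (ModuleCat.{0} ℚ) _ k)

/-- The elements `v γ` of `V` at the times `s γ` generate a decomposition of the persistence
module `V` as the direct sum of the interval modules of `[s γ, t γ)`: there is an isomorphism from
that direct sum to `V` which takes the generator of the summand `γ` to `v γ`. -/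
def IsIntervalDecomposition {Γ : Type} (s : Γ → ℝ≥0) (t : Γ → WithTop ℝ≥0) (V : PVec)
    (v : ∀ γ, V.obj (s γ)) : Prop :=
  (∀ γ, (s γ : WithTop ℝ≥0) < t γ) ∧
  ∃ e : (∐ fun γ => intervalModule (s γ) (t γ)) ≅ V,
    ∀ γ, (Sigma.ι (fun γ => intervalModule (s γ) (t γ)) γ ≫ e.hom).app (s γ)
      (intervalModule.gen (s γ) (t γ)) = v γ

/-- The map `f : A ⟶ B` attaches to `A` simultaneously, for every `k` and every `γ : Γ k`, a cell
`D_s^{k + 1}` along the interval sphere of degree `k + 1` on `[s, t)`, where `s = s k γ` and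
`t = t k γ`, and `b k γ`, of degree `k` and at time `s`, is the element of `B` defined by that
cell. -/
def IsCellAttachment {Γ : ℕ → Type} (s : ∀ k, Γ k → ℝ≥0) (t : ∀ k, Γ k → WithTop ℝ≥0)
    {A B : PCh} (f : A ⟶ B) (b : ∀ k (γ : Γ k), (B.obj (s k γ)).X k) : Prop :=
  ∃ (φ : (∐ fun γ : Σ k, Γ k => intervalSphere (γ.1 + 1) (s γ.1 γ.2) (t γ.1 γ.2)) ⟶ A)
    (ψ : (∐ fun γ : Σ k, Γ k => persistentDisk (γ.1 + 1) (s γ.1 γ.2)) ⟶ B),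
    IsPushout φ (Limits.Sigma.map fun γ => sphereToDisk (γ.1 + 1) (s γ.1 γ.2) (t γ.1 γ.2)) f ψ ∧
    ∀ (k : ℕ) (γ : Γ k),
      ((Sigma.ι (fun γ : Σ k, Γ k => persistentDisk (γ.1 + 1) (s γ.1 γ.2)) ⟨k, γ⟩ ≫ ψ).app
        (s k γ)).f k (persistentDisk.gen k (s k γ)) = b k γ

/-- The injective map `j : W ⟶ Y` identifies `W` with the subcomplex `i(X) + ZY` of `Y`. -/
def IsImageAddCocycles {X W Y : PCh} (i : X ⟶ Y) (j : W ⟶ Y) : Prop :=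
  IsInjective j ∧
  ∀ (r : ℝ≥0) (k : ℕ), LinearMap.range ((j.app r).f k).hom =
    LinearMap.range ((i.app r).f k).hom ⊔ LinearMap.ker ((Y.obj r).d k (k + 1)).hom

/-- The map `i : X ⟶ Y` factors as `X ⟶ W ⟶ Y`, where `W` is the subcomplex `i(X) + ZY` of `Y`
and where

* `X ⟶ W` attaches cells along cocycles `z k γ` of `Y` whose classes generate an interval
  decomposition of the graded persistence module `ZY / i(ZX)`;
* `W ⟶ Y` attaches cells along elements `y k δ` of `Y` whose classes generate an interval
  decomposition of the graded persistence module `Y / (i(X) + ZY)`. -/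
def IsTwoStepCellAttachment {X Y : PCh} (i : X ⟶ Y) : Prop :=
  ∃ (W : PCh) (a : X ⟶ W) (j : W ⟶ Y), a ≫ j = i ∧ IsImageAddCocycles i j ∧
    (∃ (Γ : ℕ → Type) (s : ∀ k, Γ k → ℝ≥0) (t : ∀ k, Γ k → WithTop ℝ≥0)
      (z : ∀ k (γ : Γ k), ((cocycles k).obj Y).obj (s k γ))
      (w : ∀ k (γ : Γ k), (W.obj (s k γ)).X k),
      (∀ k (γ : Γ k), (j.app (s k γ)).f k (w k γ) = (Y.obj (s k γ)).iCycles k (z k γ)) ∧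
      (∀ k, IsIntervalDecomposition (s k) (t k) (cokernel ((cocycles k).map i))
        fun γ => (cokernel.π ((cocycles k).map i)).app (s k γ) (z k γ)) ∧
      IsCellAttachment s t a w) ∧
    (∃ (Δ : ℕ → Type) (s : ∀ k, Δ k → ℝ≥0) (t : ∀ k, Δ k → WithTop ℝ≥0)
      (y : ∀ k (δ : Δ k), (Y.obj (s k δ)).X k),
      (∀ k, IsIntervalDecomposition (s k) (t k) (cokernel ((cochains k).map j))
        fun δ => (cokernel.π ((cochains k).map j)).app (s k δ) (y k δ)) ∧
      IsCellAttachment s t j y)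

end PersistentComplex

end

noncomputable section

namespace PersistentComplex

/-! The cokernel of the cell `sphereToDisk (k + 1) s t` is the interval module of `[s, t)` placed in
degree `k`: in degree `k + 1` the sphere fills the disk, while in degree `k` the disk is `ℚ` from
`s` on and the sphere is `ℚ` only from `t` on. Attaching such cells along a monomorphism therefore
amounts to decomposing its cokernel into intervals, provided the cokernel has zero differential.
This is `isCellAttachment_of_isIntervalDecomposition`: an element `b` whose class generates an
interval has its coboundary in the subobject, and from time `t` on it lies there itself, which is
exactly an attaching map from the interval sphere. The resulting square is a pushout because it
induces an isomorphism on cokernels (`isPushout_of_isIso_cokernel_map`).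

For an injective `i`, the quotient of `Y` by `X` may have a nonzero differential, which is why there
are two steps. With `W = i(X) + ZY`, the quotient of `W` by `X` is `ZY / i(ZX)` in each degree
(`IsImageAddCocycles.exists_cokernel_iso`; injectivity of `i` makes an element of `X` a cocycle as
soon as its image is one). The quotient of `Y` by `W` has zero differential since coboundaries are
cocycles.

Both graded quotients change at finitely many times, because the cochains of `X`, `Y` and `W` and
the cocycles of `X` and `Y` do. Such modules decompose into intervals without any
finite-dimensionality (`exists_isBarcode`). The argument is induction on the number of jump times:
the elements present at the first time have a basis adapted to the finite chain of kernels of the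
structure maps, and the quotient by what they generate has one jump fewer; its bars lift to elements
dying at the same times.

Finally, cell attachments are pushouts of coproducts of generating cofibrations, so the composite of
the two is a cofibration; cofibrancy is the case of the zero object as source. -/

/-! ### Bases adapted to a finite chain of subspaces -/

/-- A finite chain of subspaces, indexed by a monotone family, has an adapted linearly independent
set, which spans each of its members. -/
theorem exists_linearIndepOn_adapted {ι E : Type*} [LinearOrder ι] [AddCommGroup E] [Module ℚ E]
    (K : ι → Submodule ℚ E) (C : Finset ι) (hK : MonotoneOn K C) :
    ∃ B : Set E, LinearIndepOn ℚ id B ∧ (∀ v ∈ B, ∃ c ∈ C, v ∈ K c) ∧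
      ∀ c ∈ C, K c ≤ Submodule.span ℚ (B ∩ K c) := by
  induction C using Finset.induction_on_max with
  | empty => exact ⟨∅, linearIndepOn_empty _ _, by simp, by simp⟩
  | insert a C ha ih =>
    obtain ⟨B, hB, hBC, hspan⟩ := ih (hK.mono (by simp))
    have hBa : B ⊆ K a := fun v hv => by
      obtain ⟨c, hc, hvc⟩ := hBC v hv
      exact hK (by simp [hc]) (by simp) (ha c hc).le hvc
    -- The largest member of the chain contains everything chosen so far, so the set can be extended
    -- to a basis of it without disturbing the smaller members.
    obtain ⟨B', hB'K, hBB', hKB', hB'⟩ := exists_linearIndepOn_id_extension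
      hB hBa
    refine ⟨B', hB', fun v hv => ⟨a, by simp, hB'K hv⟩, fun c hc => ?_⟩
    rcases Finset.mem_insert.1 hc with rfl | hc
    · rw [Set.inter_eq_self_of_subset_left hB'K]
      exact hKB'
    · exact (hspan c hc).trans (Submodule.span_mono (Set.inter_subset_inter_left _ hBB'))

/-! ### Barcodes -/

section Barcodes

variable {V : PVec}

theorem map_map_apply {a b c : ℝ≥0} (h : a ≤ b) (h' : b ≤ c) (v : V.obj a) :
    V.map (homOfLE h') (V.map (homOfLE h) v) = V.map (homOfLE (h.trans h')) v := by
  rw [← ConcreteCategory.comp_apply, ← V.map_comp]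
  rfl

theorem map_refl_apply {a : ℝ≥0} (v : V.obj a) : V.map (homOfLE le_rfl) v = v := by
  change V.map (𝟙 a) v = v
  simp

/-- The elements `v γ` of `V` at the times `s γ` vanish at the times `t γ`, and those which are
alive at a time `r` form a basis of `V` at `r`. -/
structure IsBarcode {Γ : Type} (s : Γ → ℝ≥0) (t : Γ → WithTop ℝ≥0) (V : PVec)
    (v : ∀ γ, V.obj (s γ)) : Prop where
  lt : ∀ γ, (s γ : WithTop ℝ≥0) < t γ
  dies : ∀ γ r (h : s γ ≤ r), t γ ≤ (r : WithTop ℝ≥0) → V.map (homOfLE h) (v γ) = 0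
  linearIndependent : ∀ r, LinearIndependent ℚ
    fun γ : {γ // s γ ≤ r ∧ (r : WithTop ℝ≥0) < t γ} => V.map (homOfLE γ.2.1) (v γ.1)
  span : ∀ r, ⊤ ≤ Submodule.span ℚ (Set.range
    fun γ : {γ // s γ ≤ r ∧ (r : WithTop ℝ≥0) < t γ} => V.map (homOfLE γ.2.1) (v γ.1))

/-- The persistence module `V` can change only at the times in `T`. -/
def JumpsIn (V : PVec) (T : Finset ℝ≥0) : Prop :=
  ∀ (a b : ℝ≥0) (h : a ≤ b), (∀ t ∈ T, a < t → b < t) →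
    Function.Bijective (V.map (homOfLE h))

/-- The persistence module `V` vanishes at times preceding all of `T`. -/
def VanishesBefore (V : PVec) (T : Finset ℝ≥0) : Prop :=
  ∀ r : ℝ≥0, (∀ t ∈ T, r < t) → Subsingleton (V.obj r)

/-- The quotient of a persistence module by a family of submodules preserved by the structure
maps. -/
def quotient (V : PVec) (U : ∀ r, Submodule ℚ (V.obj r))
    (hU : ∀ a b (φ : a ⟶ b), U a ≤ (U b).comap (V.map φ).hom) : PVec where
  obj r := ModuleCat.of ℚ (V.obj r ⧸ U r)
  map {a b} φ := ModuleCat.ofHom (Submodule.mapQ _ _ (V.map φ).hom (hU a b φ))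
  map_id r := by
    apply ModuleCat.hom_ext
    apply Submodule.linearMap_qext
    ext x
    simp
  map_comp f g := by
    apply ModuleCat.hom_ext
    apply Submodule.linearMap_qext
    ext x
    simp

theorem quotient_map_mk (V : PVec) (U : ∀ r, Submodule ℚ (V.obj r))
    (hU : ∀ a b (φ : a ⟶ b), U a ≤ (U b).comap (V.map φ).hom) {a b : ℝ≥0} (φ : a ⟶ b)
    (x : V.obj a) :
    (quotient V U hU).map φ (Submodule.Quotient.mk x) = Submodule.Quotient.mk (V.map φ x) := rfl

/-- The submodule of `V r` generated by `V σ`. -/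
def imageFrom (V : PVec) (σ r : ℝ≥0) : Submodule ℚ (V.obj r) :=
  open Classical in if h : σ ≤ r then LinearMap.range (V.map (homOfLE h)).hom else ⊥

theorem imageFrom_of_le {σ r : ℝ≥0} (h : σ ≤ r) :
    imageFrom V σ r = LinearMap.range (V.map (homOfLE h)).hom := dif_pos h

theorem mem_imageFrom {σ r : ℝ≥0} (h : σ ≤ r) {x : V.obj r} :
    x ∈ imageFrom V σ r ↔ ∃ u, V.map (homOfLE h) u = x := by
  rw [imageFrom_of_le h]; rfl

theorem imageFrom_le_comap (σ a b : ℝ≥0) (φ : a ⟶ b) :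
    imageFrom V σ a ≤ (imageFrom V σ b).comap (V.map φ).hom := by
  by_cases h : σ ≤ a
  · intro x hx
    obtain ⟨u, rfl⟩ := (mem_imageFrom h).1 hx
    exact (mem_imageFrom (h.trans (leOfHom φ))).2 ⟨u, (map_map_apply h (leOfHom φ) u).symm⟩
  · rw [imageFrom, dif_neg h]
    exact bot_le

/-- The bars born at the first time: `V σ` has a basis adapted to the kernels of the structure
maps. -/
theorem exists_initial_bars {σ : ℝ≥0} {T : Finset ℝ≥0} (hσ : ∀ t ∈ T, σ < t)
    (hV : JumpsIn V (insert σ T)) :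
    ∃ (B : Set (V.obj σ)) (t : B → WithTop ℝ≥0),
      (∀ v : B, (σ : WithTop ℝ≥0) < t v) ∧
      (∀ (v : B) (r : ℝ≥0) (h : σ ≤ r), t v ≤ (r : WithTop ℝ≥0) → V.map (homOfLE h) v.1 = 0) ∧
      ∀ (r : ℝ≥0) (h : σ ≤ r),
        LinearIndependent ℚ (fun v : {v : B // (r : WithTop ℝ≥0) < t v} =>
          V.map (homOfLE h) v.1.1) ∧
        imageFrom V σ r ≤ Submodule.span ℚ (Set.range
          fun v : {v : B // (r : WithTop ℝ≥0) < t v} => V.map (homOfLE h) v.1.1) := by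
  classical
  let K : ℝ≥0 → Submodule ℚ (V.obj σ) := fun r =>
    if h : σ ≤ r then LinearMap.ker (V.map (homOfLE h)).hom else ⊥
  have memK : ∀ {r : ℝ≥0} (h : σ ≤ r) {v : V.obj σ}, v ∈ K r ↔ V.map (homOfLE h) v = 0 := by
    intro r h v
    simp only [K, dif_pos h]
    rfl
  have hKmono : ∀ {a b : ℝ≥0}, σ ≤ a → a ≤ b → K a ≤ K b := by
    intro a b ha hab v hv
    rw [memK ha] at hv
    rw [memK (ha.trans hab), ← map_map_apply ha hab, hv, map_zero]
  obtain ⟨B₀, hB₀, -, hB₀span⟩ := exists_linearIndepOn_adapted K T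
    (fun a ha b _ hab => hKmono (hσ a ha).le hab)
  obtain ⟨B, -, hBB, hBtop, hB⟩ := exists_linearIndepOn_id_extension hB₀
    (Set.subset_univ _)
  have hspan : ∀ c ∈ T, K c ≤ Submodule.span ℚ (B ∩ K c) := fun c hc =>
    (hB₀span c hc).trans (Submodule.span_mono (Set.inter_subset_inter_left _ hBB))
  -- The kernel changes only at jump times, so it agrees with the one at the last time of `T` up to
  -- `r`, or is zero if there is none. A basis adapted to the times in `T` is thus adapted to all `r
  -- ≥ σ`.
  have hKr : ∀ r, σ ≤ r → K r = ⊥ ∨ ∃ c ∈ T, c ≤ r ∧ K r = K c := by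
    intro r hr
    rcases (T.filter (· ≤ r)).eq_empty_or_nonempty with he | hne
    · left
      rw [eq_bot_iff]
      intro v hv
      rw [memK hr] at hv
      have := hV σ r hr (by
        intro t ht hlt
        rcases Finset.mem_insert.1 ht with rfl | ht
        · exact absurd hlt (lt_irrefl _)
        · by_contra hle
          have : t ∈ T.filter (· ≤ r) := by simp [ht, not_lt.1 hle]
          simp [he] at this)
      exact this.1 (hv.trans (map_zero _).symm)
    · right
      set c := (T.filter (· ≤ r)).max' hne with hc
      have hcm := Finset.mem_filter.1 ((T.filter (· ≤ r)).max'_mem hne)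
      rw [← hc] at hcm
      refine ⟨c, hcm.1, hcm.2, le_antisymm (fun v hv => ?_)
        (hKmono (hσ c hcm.1).le hcm.2)⟩
      have hσc := (hσ c hcm.1).le
      rw [memK hr, ← map_map_apply hσc hcm.2] at hv
      rw [memK hσc]
      refine (hV c r hcm.2 ?_).1 (hv.trans (map_zero _).symm)
      intro t ht hlt
      rcases Finset.mem_insert.1 ht with rfl | ht
      · exact absurd hlt (not_lt.2 hσc)
      · by_contra hle
        exact absurd ((T.filter (· ≤ r)).le_max' t (by simp [ht, not_lt.1 hle]))
          (not_le.2 hlt)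
  -- The death time: the minimum of the empty set is `⊤`, as it should be for a basis vector that
  -- never dies.
  let t : B → WithTop ℝ≥0 := fun v => (T.filter (fun c => v.1 ∈ K c)).min
  have ht_of_mem : ∀ (v : B) (r : ℝ≥0), σ ≤ r → v.1 ∈ K r → t v ≤ (r : WithTop ℝ≥0) := by
    intro v r hr hv
    rcases hKr r hr with h | ⟨c, hc, hcr, h⟩
    · rw [h, Submodule.mem_bot] at hv
      exact absurd hv (hB.ne_zero v.2)
    · rw [h] at hv
      exact (Finset.min_le (by simp [hc, hv])).trans (WithTop.coe_le_coe.2 hcr)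
  have ht_mem : ∀ (v : B) (r : ℝ≥0), t v ≤ (r : WithTop ℝ≥0) → v.1 ∈ K r := by
    intro v r hv
    obtain ⟨c, hc⟩ := WithTop.ne_top_iff_exists.1 (ne_top_of_le_ne_top WithTop.coe_ne_top hv)
    have hcm := Finset.mem_filter.1 (Finset.mem_of_min hc.symm)
    rw [← hc] at hv
    exact hKmono (hσ c hcm.1).le (WithTop.coe_le_coe.1 hv) hcm.2
  have hKspan : ∀ r, σ ≤ r → K r ≤ Submodule.span ℚ (B ∩ K r) := by
    intro r hr
    rcases hKr r hr with h | ⟨c, hc, hcr, h⟩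
    · rw [h]; exact bot_le
    · rw [h]; exact hspan c hc
  refine ⟨B, t, ?_, ?_, ?_⟩
  · intro v
    by_contra hv
    have := ht_mem v σ (not_lt.1 hv)
    rw [memK le_rfl, map_refl_apply] at this
    exact hB.ne_zero v.2 this
  · intro v r h hv
    exact (memK h).1 (ht_mem v r hv)
  · intro r h
    constructor
    · let ι' := {v : B // (r : WithTop ℝ≥0) < t v}
      have hLI : LinearIndependent ℚ (fun v : ι' => v.1.1) :=
        hB.linearIndependent.comp (fun v : ι' => v.1) Subtype.val_injective
      refine hLI.map (f := (V.map (homOfLE h)).hom) ?_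
      have hker : LinearMap.ker (V.map (homOfLE h)).hom = K r := by
        simp only [K, dif_pos h]
      rw [hker]
      -- The basis vectors dead by time `r` span the whole kernel, so the span of the others meets
      -- the kernel trivially and their images stay independent.
      have hdis : Disjoint (Submodule.span ℚ
            ((fun v : B => (v : V.obj σ)) '' {v | (r : WithTop ℝ≥0) < t v}))
          (Submodule.span ℚ ((fun v : B => (v : V.obj σ)) '' {v | t v ≤ r})) :=
        hB.linearIndependent.disjoint_span_image (by
          rw [Set.disjoint_left]
          intro v (hv : (r : WithTop ℝ≥0) < t v) (hv' : t v ≤ (r : WithTop ℝ≥0))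
          exact (lt_of_lt_of_le hv hv').false)
      refine hdis.mono (Submodule.span_mono ?_) ((hKspan r h).trans (Submodule.span_mono ?_))
      · rintro _ ⟨v, rfl⟩
        exact ⟨v.1, v.2, rfl⟩
      · rintro v ⟨hvB, hvK⟩
        exact ⟨⟨v, hvB⟩, ht_of_mem ⟨v, hvB⟩ r h hvK, rfl⟩
    · rw [imageFrom_of_le h]
      rintro _ ⟨u, rfl⟩
      have hu : u ∈ Submodule.span ℚ B := hBtop (Set.mem_univ u)
      induction hu using Submodule.span_induction with
      | mem v hv =>
        by_cases hvr : (r : WithTop ℝ≥0) < t ⟨v, hv⟩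
        · exact Submodule.subset_span ⟨⟨⟨v, hv⟩, hvr⟩, rfl⟩
        · have := (memK h).1 (ht_mem ⟨v, hv⟩ r (not_lt.1 hvr))
          exact this ▸ Submodule.zero_mem _
      | zero => simp
      | add x y _ _ hx hy => rw [map_add]; exact Submodule.add_mem _ hx hy
      | smul c x _ hx => rw [map_smul]; exact Submodule.smul_mem _ c hx

/-- A persistence module with finitely many jumps has a barcode. -/
theorem exists_isBarcode (T : Finset ℝ≥0) (V : PVec) (hV : JumpsIn V T)
    (hV₀ : VanishesBefore V T) :
    ∃ (Γ : Type) (s : Γ → ℝ≥0) (t : Γ → WithTop ℝ≥0) (v : ∀ γ, V.obj (s γ)),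
      IsBarcode s t V v := by
  induction T using Finset.induction_on_min generalizing V with
  | empty =>
    have := fun r => hV₀ r (by simp)
    exact ⟨Empty, Empty.elim, Empty.elim, fun γ => γ.elim,
      { lt := fun γ => γ.elim
        dies := fun γ => γ.elim
        linearIndependent := fun r =>
          have : IsEmpty {γ : Empty // γ.elim ≤ r ∧ (r : WithTop ℝ≥0) < γ.elim} :=
            ⟨fun γ => γ.1.elim⟩
          linearIndependent_empty_type
        span := fun r x _ => by
          rw [Subsingleton.elim x 0]
          exact Submodule.zero_mem _ }⟩
  | insert σ T hσ ih =>
    have hV₁ : ∀ r, r < σ → Subsingleton (V.obj r) := fun r hr => hV₀ r (by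
      intro t ht
      rcases Finset.mem_insert.1 ht with rfl | ht
      · exact hr
      · exact hr.trans (hσ t ht))
    -- Dividing out everything coming from time `σ` makes the module vanish until the next jump
    -- time, so `σ` is no longer a jump.
    let Q := quotient V (imageFrom V σ) (imageFrom_le_comap σ)
    have hQ₀ : VanishesBefore Q T := by
      intro r hr
      refine ⟨fun x y => ?_⟩
      obtain ⟨x, rfl⟩ := Submodule.Quotient.mk_surjective _ x
      obtain ⟨y, rfl⟩ := Submodule.Quotient.mk_surjective _ y
      rcases lt_or_ge r σ with h | h
      · have := hV₁ r h
        rw [Subsingleton.elim x y]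
      · have hall : ∀ z : V.obj r, z ∈ imageFrom V σ r := fun z =>
          (mem_imageFrom h).2 ((hV σ r h (by
            intro t ht hlt
            rcases Finset.mem_insert.1 ht with rfl | ht
            · exact absurd hlt (lt_irrefl _)
            · exact hr t ht)).2 z)
        exact (Submodule.Quotient.eq _).2 (hall _)
    have hQ : JumpsIn Q T := by
      intro a b h hab
      rcases lt_or_ge a σ with ha | ha
      · have hb : ∀ t ∈ T, b < t := fun t ht => hab t ht (ha.trans (hσ t ht))
        have := hQ₀ a (fun t ht => h.trans_lt (hb t ht))
        have := hQ₀ b hb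
        exact ⟨fun x y _ => Subsingleton.elim _ _, fun y => ⟨0, Subsingleton.elim _ _⟩⟩
      · have hbij := hV a b h (by
          intro t ht hlt
          rcases Finset.mem_insert.1 ht with rfl | ht
          · exact absurd ha (not_le.2 hlt)
          · exact hab t ht hlt)
        constructor
        · refine (injective_iff_map_eq_zero _).2 fun x hx => ?_
          obtain ⟨x, rfl⟩ := Submodule.Quotient.mk_surjective _ x
          rw [quotient_map_mk] at hx
          obtain ⟨u, hu⟩ := (mem_imageFrom (ha.trans h)).1
            ((Submodule.Quotient.mk_eq_zero _).1 hx)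
          rw [← map_map_apply ha h] at hu
          exact (Submodule.Quotient.mk_eq_zero _).2 ((mem_imageFrom ha).2 ⟨u, hbij.1 hu⟩)
        · intro y
          obtain ⟨y, rfl⟩ := Submodule.Quotient.mk_surjective _ y
          obtain ⟨x, rfl⟩ := hbij.2 y
          exact ⟨Submodule.Quotient.mk x, rfl⟩
    obtain ⟨Γ, s, t, q, hq⟩ := ih Q hQ hQ₀
    obtain ⟨B, tB, hB₁, hB₂, hB₃⟩ := exists_initial_bars hσ hV
    -- A bar generator is nonzero at its birth, whereas `Q` is zero before `σ`.
    have hs : ∀ γ, σ ≤ s γ := by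
      intro γ
      by_contra hlt
      have := hQ₀ (s γ) (fun t ht => (not_le.1 hlt).trans (hσ t ht))
      have := (hq.linearIndependent (s γ)).ne_zero ⟨γ, le_rfl, hq.lt γ⟩
      exact this (Subsingleton.elim _ _)
    have hlift : ∀ γ, ∃ v : V.obj (s γ), (Submodule.Quotient.mk v : Q.obj (s γ)) = q γ ∧
        ∀ r (h : s γ ≤ r), t γ ≤ (r : WithTop ℝ≥0) → V.map (homOfLE h) v = 0 := by
      intro γ
      obtain ⟨v, hv⟩ := Submodule.Quotient.mk_surjective _ (q γ)
      by_cases htop : t γ = ⊤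
      · refine ⟨v, hv, fun r h hr => ?_⟩
        rw [htop] at hr
        exact absurd (WithTop.coe_lt_top r) (not_lt.2 hr)
      obtain ⟨d, hd⟩ := WithTop.ne_top_iff_exists.1 htop
      have hsd : s γ ≤ d := (WithTop.coe_lt_coe.1 (hd ▸ hq.lt γ)).le
      have h0 := hq.dies γ d hsd hd.ge
      rw [← hv] at h0
      have h0 : V.map (homOfLE hsd) v ∈ imageFrom V σ d := (Submodule.Quotient.mk_eq_zero _).1 h0
      obtain ⟨u, hu⟩ := (mem_imageFrom ((hs γ).trans hsd)).1 h0
      -- At the death time `d` an arbitrary lift need only lie in the image of `V σ`. Subtracting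
      -- the element `u` of `V σ` that it equals there leaves its class in `Q` unchanged and makes
      -- it die in `V` too.
      refine ⟨v - V.map (homOfLE (hs γ)) u, ?_, fun r h hr => ?_⟩
      · rw [← hv]
        refine (Submodule.Quotient.eq _).2 ?_
        rw [sub_sub_cancel_left]
        exact Submodule.neg_mem _ ((mem_imageFrom (hs γ)).2 ⟨u, rfl⟩)
      · have hdr : d ≤ r := WithTop.coe_le_coe.1 (hd ▸ hr)
        rw [← map_map_apply hsd hdr, map_sub, map_map_apply, hu, sub_self, map_zero]
    choose v hv hvd using hlift
    let s' : B ⊕ Γ → ℝ≥0 := Sum.elim (fun _ => σ) s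
    let t' : B ⊕ Γ → WithTop ℝ≥0 := Sum.elim tB t
    let v' : ∀ γ : B ⊕ Γ, V.obj (s' γ) := fun γ => match γ with
      | .inl x => x.1
      | .inr γ => v γ
    refine ⟨B ⊕ Γ, s', t', v', ⟨?_, ?_, fun r => ?_, fun r => ?_⟩⟩
    · rintro (x | γ)
      · exact hB₁ x
      · exact hq.lt γ
    · rintro (x | γ)
      · exact hB₂ x
      · exact hvd γ
    · rcases lt_or_ge r σ with hr | hr
      · have : IsEmpty {γ : B ⊕ Γ // s' γ ≤ r ∧ (r : WithTop ℝ≥0) < t' γ} := by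
          refine ⟨?_⟩
          rintro ⟨x | γ, h, -⟩
          · exact absurd hr (not_lt.2 h)
          · exact absurd hr (not_lt.2 ((hs γ).trans h))
        exact linearIndependent_empty_type
      -- At `r ≥ σ` the initial bars are independent inside the submodule `imageFrom V σ r`, and the
      -- lifted bars are independent modulo it; together they are independent.
      · have h₁ : LinearIndependent ℚ (fun x : {x : B // (r : WithTop ℝ≥0) < tB x} =>
            (⟨V.map (homOfLE hr) x.1.1, (mem_imageFrom hr).2 ⟨_, rfl⟩⟩ : imageFrom V σ r)) :=
          LinearIndependent.of_comp (imageFrom V σ r).subtype (hB₃ r hr).1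
        have h₂ : LinearIndependent ℚ (Submodule.Quotient.mk (p := imageFrom V σ r) ∘
            fun γ : {γ // s γ ≤ r ∧ (r : WithTop ℝ≥0) < t γ} =>
              V.map (homOfLE γ.2.1) (v γ.1)) := by
          have := hq.linearIndependent r
          simp_rw [← hv] at this
          exact this
        let e : {γ : B ⊕ Γ // s' γ ≤ r ∧ (r : WithTop ℝ≥0) < t' γ} →
            {x : B // (r : WithTop ℝ≥0) < tB x} ⊕
              {γ // s γ ≤ r ∧ (r : WithTop ℝ≥0) < t γ} := fun γ => match γ with
          | ⟨.inl x, h⟩ => .inl ⟨x, h.2⟩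
          | ⟨.inr γ, h⟩ => .inr ⟨γ, h⟩
        have he : Function.Injective e := by
          rintro ⟨x | x, hx⟩ ⟨y | y, hy⟩ h
          · exact Subtype.ext (congrArg Sum.inl (congrArg Subtype.val (Sum.inl.inj h)))
          · exact absurd h Sum.inl_ne_inr
          · exact absurd h Sum.inr_ne_inl
          · exact Subtype.ext (congrArg Sum.inr (congrArg Subtype.val (Sum.inr.inj h)))
        convert! (h₁.sumElim_of_quotient _ h₂).comp e he using 2 with γ
        rcases γ with ⟨x | x, hx⟩ <;> rfl
    · rcases lt_or_ge r σ with hr | hr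
      · intro x _
        have := hV₁ r hr
        rw [Subsingleton.elim x 0]
        exact Submodule.zero_mem _
      -- The span contains the submodule and surjects onto the quotient by it, hence is everything.
      · set S := Submodule.span ℚ (Set.range
          fun γ : {γ // s' γ ≤ r ∧ (r : WithTop ℝ≥0) < t' γ} => V.map (homOfLE γ.2.1) (v' γ.1))
          with hS
        have hU : imageFrom V σ r ≤ S := (hB₃ r hr).2.trans (Submodule.span_mono (by
          rintro _ ⟨x, rfl⟩
          exact ⟨⟨.inl x.1, hr, x.2⟩, rfl⟩))
        have hmap : Submodule.map (imageFrom V σ r).mkQ S = ⊤ := by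
          refine top_unique ((hq.span r).trans (Submodule.span_le.2 ?_))
          rintro _ ⟨γ, rfl⟩
          refine ⟨V.map (homOfLE γ.2.1) (v γ.1),
            Submodule.subset_span ⟨⟨.inr γ.1, γ.2⟩, rfl⟩, ?_⟩
          dsimp only
          rw [← hv]
          rfl
        intro x _
        obtain ⟨y, hy, hxy⟩ : (imageFrom V σ r).mkQ x ∈ Submodule.map (imageFrom V σ r).mkQ S :=
          hmap ▸ Submodule.mem_top
        have := hU ((Submodule.Quotient.eq _).1 hxy)
        simpa using S.sub_mem hy this

end Barcodes

/-! ### Maps out of copies of `ℚ` -/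

theorem QIf.subsingleton {P : Prop} (h : ¬ P) : Subsingleton (QIf P) :=
  ⟨fun _ _ => funext fun p => absurd p.down h⟩

theorem QIf.eq_smul_one {P : Prop} (h : P) (x : QIf P) :
    x = (show PLift P → ℚ from x) ⟨h⟩ • QIf.one P := by
  funext p
  change x p = x ⟨h⟩ * 1
  rw [mul_one]

theorem QIf.hom_ext {P : Prop} {M : ModuleCat.{0} ℚ} {f g : QIf P ⟶ M}
    (h : f (QIf.one P) = g (QIf.one P)) : f = g := by
  apply ModuleCat.hom_ext
  apply LinearMap.ext
  intro x
  by_cases hP : P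
  · rw [QIf.eq_smul_one hP x, map_smul, map_smul]
    exact congrArg _ h
  · have := QIf.subsingleton hP
    rw [Subsingleton.elim x 0, map_zero, map_zero]

open Classical in
/-- The map `QIf P ⟶ M` which takes `1` to `x`, if `P` holds. -/
def QIf.desc (P : Prop) {M : ModuleCat.{0} ℚ} (x : M) : QIf P ⟶ M :=
  ModuleCat.ofHom
    (if h : P then (LinearMap.proj (⟨h⟩ : PLift P) : (PLift P → ℚ) →ₗ[ℚ] ℚ).smulRight x else 0)

theorem QIf.desc_one {P : Prop} {M : ModuleCat.{0} ℚ} (x : M) (h : P) :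
    QIf.desc P x (QIf.one P) = x := by
  simp only [QIf.desc, dif_pos h]
  change (1 : ℚ) • x = x
  exact one_smul _ _

theorem QIf.one_eq_zero {P : Prop} (h : ¬ P) : QIf.one P = 0 :=
  (QIf.subsingleton h).elim _ _

theorem QIf.map_one {P Q : Prop} (h : P) : QIf.map P Q (QIf.one P) = QIf.one Q := by
  funext q
  exact QIf.linearMap_of Q h _ q

/-! ### Interval modules -/

section IntervalModules

variable {V : PVec} {s : ℝ≥0} {t : WithTop ℝ≥0}

/-- The element `1` of the interval module of `[s, t)` at time `r`, which is `0` if `r` does not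
lie in `[s, t)`. -/
def intervalModule.one (s : ℝ≥0) (t : WithTop ℝ≥0) (r : ℝ≥0) : (intervalModule s t).obj r :=
  QIf.one _

theorem intervalModule.one_eq_zero {r : ℝ≥0} (h : ¬ (s ≤ r ∧ (r : WithTop ℝ≥0) < t)) :
    intervalModule.one s t r = 0 :=
  QIf.one_eq_zero h

theorem intervalModule.map_one {r r' : ℝ≥0} (φ : r ⟶ r') (hr : s ≤ r)
    (hr' : (r : WithTop ℝ≥0) < t) :
    (intervalModule s t).map φ (intervalModule.one s t r) = intervalModule.one s t r' :=
  QIf.map_one ⟨hr, hr'⟩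

theorem intervalModule.obj_hom_ext {r : ℝ≥0} {M : ModuleCat.{0} ℚ}
    {f g : (intervalModule s t).obj r ⟶ M}
    (h : f (intervalModule.one s t r) = g (intervalModule.one s t r)) : f = g :=
  QIf.hom_ext h

/-- The map from an interval module at time `r` which takes `1` to `x`, if `r` lies in the
interval. -/
def intervalModule.objDesc (s : ℝ≥0) (t : WithTop ℝ≥0) (r : ℝ≥0) {M : ModuleCat.{0} ℚ} (x : M) :
    (intervalModule s t).obj r ⟶ M :=
  QIf.desc _ x

theorem intervalModule.objDesc_one {r : ℝ≥0} {M : ModuleCat.{0} ℚ} (x : M) (h : s ≤ r)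
    (h' : (r : WithTop ℝ≥0) < t) :
    intervalModule.objDesc s t r x (intervalModule.one s t r) = x :=
  QIf.desc_one x ⟨h, h'⟩

theorem intervalModule.hom_ext {f g : intervalModule s t ⟶ V}
    (h : f.app s (intervalModule.gen s t) = g.app s (intervalModule.gen s t)) : f = g := by
  ext1
  ext1 r
  apply intervalModule.obj_hom_ext
  by_cases hr : s ≤ r ∧ (r : WithTop ℝ≥0) < t
  · rw [← intervalModule.map_one (homOfLE hr.1) le_rfl
      (lt_of_le_of_lt (WithTop.coe_le_coe.2 hr.1) hr.2), NatTrans.naturality_apply,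
      NatTrans.naturality_apply]
    exact congrArg _ h
  · rw [intervalModule.one_eq_zero hr, map_zero, map_zero]

open Classical in
/-- The map from the interval module of `[s, t)` defined by an element of `V` at time `s` which
vanishes at time `t`. -/
def intervalModule.desc (v : V.obj s)
    (hv : ∀ r (h : s ≤ r), t ≤ (r : WithTop ℝ≥0) → V.map (homOfLE h) v = 0) :
    intervalModule s t ⟶ V where
  app r := if h : s ≤ r then intervalModule.objDesc s t r (V.map (homOfLE h) v) else 0
  naturality r r' φ := by
    apply intervalModule.obj_hom_ext
    rw [ConcreteCategory.comp_apply, ConcreteCategory.comp_apply]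
    by_cases hr : s ≤ r ∧ (r : WithTop ℝ≥0) < t
    · rw [dif_pos hr.1, dif_pos (hr.1.trans (leOfHom φ)),
        intervalModule.objDesc_one _ hr.1 hr.2, intervalModule.map_one _ hr.1 hr.2]
      refine Eq.trans ?_ (map_map_apply hr.1 (leOfHom φ) v).symm
      by_cases hr' : (r' : WithTop ℝ≥0) < t
      · exact intervalModule.objDesc_one _ (hr.1.trans (leOfHom φ)) hr'
      · rw [intervalModule.one_eq_zero (fun h => hr' h.2), map_zero, hv _ _ (not_lt.1 hr')]
    · rw [intervalModule.one_eq_zero hr, map_zero, map_zero, map_zero, map_zero]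

theorem intervalModule.desc_app_one (v : V.obj s)
    (hv : ∀ r (h : s ≤ r), t ≤ (r : WithTop ℝ≥0) → V.map (homOfLE h) v = 0) {r : ℝ≥0}
    (h : s ≤ r) (h' : (r : WithTop ℝ≥0) < t) :
    (intervalModule.desc v hv).app r (intervalModule.one s t r) = V.map (homOfLE h) v := by
  dsimp only [intervalModule.desc]
  rw [dif_pos h, intervalModule.objDesc_one _ h h']

end IntervalModules

/-- A barcode yields an interval decomposition. -/
theorem IsBarcode.isIntervalDecomposition {Γ : Type} {s : Γ → ℝ≥0} {t : Γ → WithTop ℝ≥0}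
    {V : PVec} {v : ∀ γ, V.obj (s γ)} (hv : IsBarcode s t V v) :
    IsIntervalDecomposition s t V v := by
  refine ⟨hv.lt, ?_⟩
  let F : ∀ γ, intervalModule (s γ) (t γ) ⟶ V := fun γ =>
    intervalModule.desc (v γ) (hv.dies γ)
  let b := fun r => Module.Basis.mk (hv.linearIndependent r) (hv.span r)
  have hb : ∀ r (γ) (h : s γ ≤ r) (h' : (r : WithTop ℝ≥0) < t γ),
      (F γ).app r (intervalModule.one _ _ r) = b r ⟨γ, h, h'⟩ := by
    intro r γ h h'
    simp only [b, Module.Basis.mk_apply]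
    exact intervalModule.desc_app_one (v γ) (hv.dies γ) h h'
  have hc : IsColimit (Cofan.mk V F) := by
    -- Colimits of persistence modules are pointwise. At time `r` the summands alive are copies of
    -- `ℚ` indexed by the basis `b r`, and all others are zero.
    refine evaluationJointlyReflectsColimits _ fun r =>
      (isColimitMapCoconeCofanMkEquiv ((evaluation _ _).obj r) _ _).symm ?_
    let D : ∀ {M : ModuleCat.{0} ℚ} (_ : ∀ γ, (intervalModule (s γ) (t γ)).obj r ⟶ M),
        V.obj r ⟶ M := fun g =>
      ModuleCat.ofHom ((b r).constr ℚ fun γ => g γ.1 (intervalModule.one _ _ r))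
    have hD : ∀ {M : ModuleCat.{0} ℚ} (g : ∀ γ, (intervalModule (s γ) (t γ)).obj r ⟶ M) γ,
        D g (b r γ) = g γ.1 (intervalModule.one _ _ r) := fun g γ =>
      (b r).constr_basis ℚ _ _
    refine Cofan.IsColimit.mk _ (fun T => D T.inj) ?_ ?_
    · intro T γ
      change (F γ).app r ≫ D T.inj = T.inj γ
      apply intervalModule.obj_hom_ext
      rw [ConcreteCategory.comp_apply]
      by_cases h : s γ ≤ r ∧ (r : WithTop ℝ≥0) < t γ
      · rw [hb r γ h.1 h.2, hD]
      · rw [intervalModule.one_eq_zero h, map_zero, map_zero, map_zero]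
    · intro T m hm
      replace hm : ∀ γ, (F γ).app r ≫ m = T.inj γ := hm
      apply ModuleCat.hom_ext
      refine (b r).ext fun γ => ?_
      refine Eq.trans ?_ (hD T.inj γ).symm
      rw [← hm, ConcreteCategory.comp_apply, hb r γ.1 γ.2.1 γ.2.2]
  refine ⟨(coproductIsCoproduct _).coconePointUniqueUpToIso hc, fun γ => ?_⟩
  have := (coproductIsCoproduct fun γ => intervalModule (s γ) (t γ)).comp_coconePointUniqueUpToIso_hom
    hc ⟨γ⟩
  refine (congrArg (fun f => f.app (s γ) (intervalModule.gen (s γ) (t γ))) this).trans ?_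
  refine (intervalModule.desc_app_one (v γ) (hv.dies γ) le_rfl (hv.lt γ)).trans ?_
  exact map_refl_apply _

/-! ### Interval decompositions and isomorphisms -/

theorem IsIntervalDecomposition.of_iso {Γ : Type} {s : Γ → ℝ≥0} {t : Γ → WithTop ℝ≥0}
    {V V' : PVec} {v : ∀ γ, V.obj (s γ)} {v' : ∀ γ, V'.obj (s γ)}
    (h : IsIntervalDecomposition s t V v) (i : V ≅ V')
    (hv : ∀ γ, i.hom.app (s γ) (v γ) = v' γ) : IsIntervalDecomposition s t V' v' := by
  obtain ⟨hlt, e, he⟩ := h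
  refine ⟨hlt, e ≪≫ i, fun γ => ?_⟩
  rw [← hv, ← he, Iso.trans_hom, ← Category.assoc, NatTrans.comp_app, ConcreteCategory.comp_apply]

theorem IsIntervalDecomposition.map_eq_zero {Γ : Type} {s : Γ → ℝ≥0} {t : Γ → WithTop ℝ≥0}
    {V : PVec} {v : ∀ γ, V.obj (s γ)} (h : IsIntervalDecomposition s t V v) (γ : Γ) {r : ℝ≥0}
    (hs : s γ ≤ r) (ht : t γ ≤ (r : WithTop ℝ≥0)) : V.map (homOfLE hs) (v γ) = 0 := by
  obtain ⟨hlt, e, he⟩ := h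
  rw [← he]
  refine (NatTrans.naturality_apply _ (homOfLE hs) _).symm.trans ?_
  have : (intervalModule (s γ) (t γ)).map (homOfLE hs) (intervalModule.gen (s γ) (t γ)) = 0 :=
    (intervalModule.map_one (homOfLE hs) le_rfl (hlt γ)).trans
      (intervalModule.one_eq_zero fun h => (lt_of_lt_of_le h.2 ht).false)
  rw [this, map_zero]

theorem IsIntervalDecomposition.hom_ext {Γ : Type} {s : Γ → ℝ≥0} {t : Γ → WithTop ℝ≥0}
    {V : PVec} {v : ∀ γ, V.obj (s γ)} (h : IsIntervalDecomposition s t V v) {T : PVec}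
    {f g : V ⟶ T} (hfg : ∀ γ, f.app (s γ) (v γ) = g.app (s γ) (v γ)) : f = g := by
  obtain ⟨hlt, e, he⟩ := h
  rw [← cancel_epi e.hom]
  refine Sigma.hom_ext _ _ fun γ => ?_
  apply intervalModule.hom_ext
  have := hfg γ
  rw [← he] at this
  exact this

/-- The universal property of the direct sum, phrased through the generators `v`. With
`IsIntervalDecomposition.hom_ext` it supplies the inverse of the comparison of cokernels in
`isCellAttachment_of_isIntervalDecomposition`. -/
theorem IsIntervalDecomposition.exists_desc {Γ : Type} {s : Γ → ℝ≥0} {t : Γ → WithTop ℝ≥0}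
    {V : PVec} {v : ∀ γ, V.obj (s γ)} (h : IsIntervalDecomposition s t V v) {T : PVec}
    (g : ∀ γ, intervalModule (s γ) (t γ) ⟶ T) :
    ∃ f : V ⟶ T, ∀ γ, f.app (s γ) (v γ) = (g γ).app (s γ) (intervalModule.gen (s γ) (t γ)) := by
  obtain ⟨hlt, e, he⟩ := h
  refine ⟨e.inv ≫ Sigma.desc g, fun γ => ?_⟩
  rw [← he]
  have : (Sigma.ι (fun γ => intervalModule (s γ) (t γ)) γ ≫ e.hom) ≫ e.inv ≫ Sigma.desc g =
      g γ := by simp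
  exact congrArg (fun f => f.app (s γ) (intervalModule.gen (s γ) (t γ))) this

/-! ### The persistent disks and interval spheres in a fixed degree -/

section Disks

variable {k : ℕ} {s : ℝ≥0} {t : WithTop ℝ≥0}

/-- The element `1` of a persistent disk at time `r` in degree `j`. -/
def persistentDisk.one (k : ℕ) (s r : ℝ≥0) (j : ℕ) : ((persistentDisk k s).obj r).X j := QIf.one _

/-- The element `1` of an interval sphere at time `r` in degree `j`. -/
def intervalSphere.one (k : ℕ) (s : ℝ≥0) (t : WithTop ℝ≥0) (r : ℝ≥0) (j : ℕ) :
    ((intervalSphere k s t).obj r).X j := QIf.one _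

theorem persistentDisk.one_eq_zero {r : ℝ≥0} {j : ℕ} (h : ¬ diskSupport k s r j) :
    persistentDisk.one k s r j = 0 :=
  QIf.one_eq_zero h

theorem intervalSphere.one_eq_zero {r : ℝ≥0} {j : ℕ} (h : ¬ sphereSupport k s t r j) :
    intervalSphere.one k s t r j = 0 :=
  QIf.one_eq_zero h

theorem persistentDisk.map_one {r r' : ℝ≥0} (φ : r ⟶ r') {j : ℕ} (h : diskSupport k s r j) :
    ((persistentDisk k s).map φ).f j (persistentDisk.one k s r j) = persistentDisk.one k s r' j :=
  QIf.map_one h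

theorem persistentDisk.d_one {r : ℝ≥0} {j : ℕ} (h : diskSupport k s r j) :
    ((persistentDisk k s).obj r).d j (j + 1) (persistentDisk.one k s r j) =
      persistentDisk.one k s r (j + 1) := by
  have : ((persistentDisk k s).obj r).d j (j + 1) =
      QIf.map (diskSupport k s r j) (diskSupport k s r (j + 1)) := if_pos rfl
  rw [this]
  exact QIf.map_one h

theorem sphereToDisk_one {r : ℝ≥0} {j : ℕ} (h : sphereSupport k s t r j) :
    ((sphereToDisk k s t).app r).f j (intervalSphere.one k s t r j) =
      persistentDisk.one k s r j :=
  QIf.map_one h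

theorem persistentDisk.X_hom_ext {r : ℝ≥0} {j : ℕ} {M : ModuleCat.{0} ℚ}
    {f g : ((persistentDisk k s).obj r).X j ⟶ M}
    (h : f (persistentDisk.one k s r j) = g (persistentDisk.one k s r j)) : f = g :=
  QIf.hom_ext h

theorem intervalSphere.X_hom_ext {r : ℝ≥0} {j : ℕ} {M : ModuleCat.{0} ℚ}
    {f g : ((intervalSphere k s t).obj r).X j ⟶ M}
    (h : f (intervalSphere.one k s t r j) = g (intervalSphere.one k s t r j)) : f = g :=
  QIf.hom_ext h

/-- The map from a persistent disk at time `r` in degree `j` which takes `1` to `x`, if this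
makes sense. -/
def persistentDisk.XDesc (k : ℕ) (s r : ℝ≥0) (j : ℕ) {M : ModuleCat.{0} ℚ} (x : M) :
    ((persistentDisk k s).obj r).X j ⟶ M :=
  QIf.desc _ x

theorem persistentDisk.XDesc_one {r : ℝ≥0} {j : ℕ} {M : ModuleCat.{0} ℚ} (x : M)
    (h : diskSupport k s r j) :
    persistentDisk.XDesc k s r j x (persistentDisk.one k s r j) = x :=
  QIf.desc_one x h

theorem diskSupport_self {r : ℝ≥0} (h : s ≤ r) : diskSupport (k + 1) s r k :=
  ⟨h, by omega, by omega⟩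

theorem diskSupport_succ {r : ℝ≥0} (h : s ≤ r) : diskSupport (k + 1) s r (k + 1) :=
  ⟨h, by omega, by omega⟩

/-- Maps from a persistent disk in its lower degree are determined by the generator. -/
theorem persistentDisk.cochains_hom_ext {V : PVec}
    {f g : (cochains k).obj (persistentDisk (k + 1) s) ⟶ V}
    (h : f.app s (persistentDisk.gen k s) = g.app s (persistentDisk.gen k s)) : f = g := by
  ext1
  ext1 r
  apply persistentDisk.X_hom_ext
  by_cases hr : s ≤ r
  · have h1 : ((cochains k).obj (persistentDisk (k + 1) s)).map (homOfLE hr)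
        (persistentDisk.gen k s) = persistentDisk.one (k + 1) s r k :=
      persistentDisk.map_one (homOfLE hr) (diskSupport_self le_rfl)
    rw [← h1]
    refine (NatTrans.naturality_apply f (homOfLE hr) _).trans ?_
    refine Eq.trans ?_ (NatTrans.naturality_apply g (homOfLE hr) _).symm
    rw [h]
  · rw [persistentDisk.one_eq_zero (fun h => hr h.1), map_zero, map_zero]

/-- Outside of its two degrees, a persistent disk is zero. -/
theorem persistentDisk.cochains_eq {j : ℕ} (h₁ : j ≠ k) (h₂ : j ≠ k + 1) {V : PVec}
    (f g : (cochains j).obj (persistentDisk (k + 1) s) ⟶ V) : f = g := by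
  ext1
  ext1 r
  apply persistentDisk.X_hom_ext
  rw [persistentDisk.one_eq_zero (by rintro ⟨-, -, h⟩; omega), map_zero, map_zero]

/-- In the top degree the sphere and the disk have the same support, namely all times from `s` on.
Hence the cokernel of the cell has nothing in degree `k + 1`. -/
instance epi_cochains_sphereToDisk :
    Epi ((cochains (k + 1)).map (sphereToDisk (k + 1) s t)) where
  left_cancellation {V} f g h := by
    ext1
    ext1 r
    apply persistentDisk.X_hom_ext
    by_cases hr : s ≤ r
    · have hs : sphereSupport (k + 1) s t r (k + 1) :=
        ⟨hr, (lt_or_ge _ _).imp (fun h => ⟨h, rfl⟩) fun h => ⟨h, by omega, Or.inl rfl⟩⟩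
      rw [← sphereToDisk_one hs]
      exact ConcreteCategory.congr_hom (congrArg (fun f => f.app r) h)
        (intervalSphere.one (k + 1) s t r (k + 1))
    · rw [persistentDisk.one_eq_zero (fun h => hr h.1), map_zero, map_zero]

/-- A map from a persistent disk in its lower degree which vanishes on the interval sphere
induces a map from the interval module. -/
theorem persistentDisk.exists_intervalModule_desc {V : PVec}
    (g : (cochains k).obj (persistentDisk (k + 1) s) ⟶ V)
    (h : (cochains k).map (sphereToDisk (k + 1) s t) ≫ g = 0) (hst : (s : WithTop ℝ≥0) < t) :
    ∃ g' : intervalModule s t ⟶ V,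
      g'.app s (intervalModule.gen s t) = g.app s (persistentDisk.gen k s) := by
  refine ⟨intervalModule.desc (g.app s (persistentDisk.gen k s)) fun r hr htr => ?_, ?_⟩
  -- From time `t` on the lower generator of the disk comes from the sphere, so `g` kills it: the
  -- image of the generator dies at `t`.
  · have hs : sphereSupport (k + 1) s t r k := ⟨hr, Or.inr ⟨htr, by omega, by omega⟩⟩
    have h1 : ((cochains k).obj (persistentDisk (k + 1) s)).map (homOfLE hr)
        (persistentDisk.gen k s) = persistentDisk.one (k + 1) s r k :=
      persistentDisk.map_one (homOfLE hr) (diskSupport_self le_rfl)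
    refine (NatTrans.naturality_apply g (homOfLE hr) _).symm.trans ?_
    rw [h1, ← sphereToDisk_one hs]
    exact ConcreteCategory.congr_hom (congrArg (fun f => f.app r) h)
      (intervalSphere.one (k + 1) s t r k)
  · exact (intervalModule.desc_app_one _ _ le_rfl hst).trans (map_refl_apply _)

end Disks

/-! ### Maps out of persistent disks -/

section DiskDesc

variable {B : PCh} {k : ℕ} {s : ℝ≥0}

theorem PCh.map_f_map_f {a b c : ℝ≥0} (h : a ≤ b) (h' : b ≤ c) (j : ℕ) (x : (B.obj a).X j) :
    (B.map (homOfLE h')).f j ((B.map (homOfLE h)).f j x) = (B.map (homOfLE (h.trans h'))).f j x :=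
  map_map_apply (V := (cochains j).obj B) h h' x

theorem PCh.map_f_d {a b : ℝ≥0} (φ : a ⟶ b) (i j : ℕ) (x : (B.obj a).X i) :
    (B.map φ).f j ((B.obj a).d i j x) = (B.obj b).d i j ((B.map φ).f i x) :=
  (ConcreteCategory.congr_hom ((B.map φ).comm i j) x).symm

theorem PCh.app_f_map_f {A : PCh} (f : A ⟶ B) {a b : ℝ≥0} (φ : a ⟶ b) (j : ℕ)
    (x : (A.obj a).X j) :
    (f.app b).f j ((A.map φ).f j x) = (B.map φ).f j ((f.app a).f j x) :=
  NatTrans.naturality_apply ((cochains j).map f) φ x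

theorem PCh.d_d (r : ℝ≥0) (i j l : ℕ) (x : (B.obj r).X i) :
    (B.obj r).d j l ((B.obj r).d i j x) = 0 :=
  ConcreteCategory.congr_hom ((B.obj r).d_comp_d i j l) x

open Classical in
/-- The image of the generator of degree `j` at time `r` under the map from a persistent disk
defined by `b`. -/
def diskElement (b : (B.obj s).X k) (r : ℝ≥0) (j : ℕ) : (B.obj r).X j :=
  if h : s ≤ r then
    if hj : k = j then hj ▸ (B.map (homOfLE h)).f k b
    -- Only `j = k + 1` matters here; in every other degree `j ≠ k` this differential is zero
    -- anyway.
    else (B.obj r).d k j ((B.map (homOfLE h)).f k b)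
  else 0

theorem diskElement_self (b : (B.obj s).X k) {r : ℝ≥0} (h : s ≤ r) :
    diskElement b r k = (B.map (homOfLE h)).f k b := by
  simp [diskElement, h]

theorem diskElement_succ (b : (B.obj s).X k) {r : ℝ≥0} (h : s ≤ r) :
    diskElement b r (k + 1) = (B.obj r).d k (k + 1) ((B.map (homOfLE h)).f k b) := by
  simp [diskElement, h]

theorem map_diskElement (b : (B.obj s).X k) {r r' : ℝ≥0} (φ : r ⟶ r') {j : ℕ}
    (h : diskSupport (k + 1) s r j) :
    (B.map φ).f j (diskElement b r j) = diskElement b r' j := by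
  obtain ⟨hs, -, rfl | h⟩ := h
  · rw [diskElement_succ b hs, diskElement_succ b (hs.trans (leOfHom φ)), PCh.map_f_d]
    exact congrArg _ (PCh.map_f_map_f hs (leOfHom φ) _ _)
  · obtain rfl : j = k := by omega
    rw [diskElement_self b hs, diskElement_self b (hs.trans (leOfHom φ))]
    exact PCh.map_f_map_f hs (leOfHom φ) _ _

/-- The map from a persistent disk defined by an element. -/
def persistentDisk.desc (b : (B.obj s).X k) : persistentDisk (k + 1) s ⟶ B where
  app r :=
    { f := fun j => persistentDisk.XDesc (k + 1) s r j (diskElement b r j)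
      comm' := by
        rintro i _ rfl
        apply persistentDisk.X_hom_ext
        rw [ConcreteCategory.comp_apply, ConcreteCategory.comp_apply]
        by_cases h : diskSupport (k + 1) s r i
        · rw [persistentDisk.XDesc_one _ h, persistentDisk.d_one h]
          obtain ⟨hs, -, rfl | hi⟩ := h
          · rw [persistentDisk.one_eq_zero (by rintro ⟨-, -, h⟩; omega), map_zero,
              diskElement_succ b hs, PCh.d_d]
          · obtain rfl : i = k := by omega
            rw [persistentDisk.XDesc_one _ (diskSupport_succ hs), diskElement_self b hs,
              diskElement_succ b hs]
        · rw [persistentDisk.one_eq_zero h, map_zero, map_zero, map_zero, map_zero] }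
  naturality r r' φ := by
    ext1 j
    change ((persistentDisk (k + 1) s).map φ).f j ≫
        persistentDisk.XDesc (k + 1) s r' j (diskElement b r' j) =
      persistentDisk.XDesc (k + 1) s r j (diskElement b r j) ≫ (B.map φ).f j
    apply persistentDisk.X_hom_ext
    rw [ConcreteCategory.comp_apply, ConcreteCategory.comp_apply]
    by_cases h : diskSupport (k + 1) s r j
    · rw [persistentDisk.map_one φ h, persistentDisk.XDesc_one _ h,
        persistentDisk.XDesc_one _ ⟨h.1.trans (leOfHom φ), h.2⟩, map_diskElement b φ h]
    · rw [persistentDisk.one_eq_zero h, map_zero, map_zero, map_zero, map_zero]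

theorem persistentDisk.desc_one (b : (B.obj s).X k) {r : ℝ≥0} {j : ℕ}
    (h : diskSupport (k + 1) s r j) :
    ((persistentDisk.desc b).app r).f j (persistentDisk.one (k + 1) s r j) =
      diskElement b r j :=
  persistentDisk.XDesc_one _ h

theorem persistentDisk.desc_gen (b : (B.obj s).X k) :
    ((persistentDisk.desc b).app s).f k (persistentDisk.gen k s) = b :=
  (persistentDisk.desc_one b (diskSupport_self le_rfl)).trans
    ((diskElement_self b le_rfl).trans (map_refl_apply (V := (cochains k).obj B) b))

end DiskDesc

/-! ### Pushouts along monomorphisms in abelian categories -/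

/-- The pushout of `t` and `l` and the object `X₄` are both extensions by `X₂`, and the pushout has
the cokernel of `l` as quotient. The five lemma for short exact sequences compares them. Only `r`
has to be mono: the map from `X₂` to the pushout is then mono as a first factor of `r`. -/
theorem isPushout_of_isIso_cokernel_map {C : Type*} [Category* C] [Abelian C]
    {X₁ X₂ X₃ X₄ : C} {t : X₁ ⟶ X₂} {l : X₁ ⟶ X₃} {r : X₂ ⟶ X₄} {b : X₃ ⟶ X₄}
    (w : l ≫ b = t ≫ r) [Mono r] (h : IsIso (cokernel.map l r t b w)) : IsPushout t l r b := by
  have hP := IsPushout.of_hasPushout t l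
  let u : pushout t l ⟶ X₄ := pushout.desc r b w.symm
  have hu₁ : pushout.inl t l ≫ u = r := pushout.inl_desc _ _ _
  have hu₂ : pushout.inr t l ≫ u = b := pushout.inr_desc _ _ _
  have : Mono (pushout.inl t l) := mono_of_mono_fac hu₁
  let S₁ := ShortComplex.mk (pushout.inl t l) (cokernel.π _) (cokernel.condition _)
  let S₂ := ShortComplex.mk r (cokernel.π _) (cokernel.condition _)
  have hS₁ : S₁.ShortExact := { exact := S₁.exact_of_g_is_cokernel (cokernelIsCokernel _) }
  have hS₂ : S₂.ShortExact := { exact := S₂.exact_of_g_is_cokernel (cokernelIsCokernel _) }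
  let c : cokernel (pushout.inl t l) ⟶ cokernel r :=
    cokernel.map _ _ (𝟙 _) u (by rw [hu₁, Category.id_comp])
  have hc : IsIso c := by
    have := isIso_cokernel_map_of_isPushout hP.flip
    have hcomp : cokernel.map _ _ _ _ hP.flip.w ≫ c = cokernel.map l r t b w := by
      ext
      simp [c, ← hu₂]
    rw [← hcomp] at h
    exact IsIso.of_isIso_comp_left (cokernel.map _ _ _ _ hP.flip.w) c
  let φ : S₁ ⟶ S₂ :=
    { τ₁ := 𝟙 _
      τ₂ := u
      τ₃ := c
      comm₁₂ := by simp [S₁, S₂, hu₁]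
      comm₂₃ := by simp [S₁, S₂, c] }
  have : IsIso u := ShortComplex.isIso₂_of_shortExact_of_isIso₁₃' φ hS₁ hS₂
    (inferInstanceAs (IsIso (𝟙 _))) hc
  exact hP.of_iso (Iso.refl _) (Iso.refl _) (Iso.refl _) (asIso u) (by simp) (by simp)
    (by simp [hu₁]) (by simp [hu₂])

/-! ### Cell attachments -/

theorem isIso_of_isIso_cochains {A B : PCh} (f : A ⟶ B)
    (h : ∀ k, IsIso ((cochains k).map f)) : IsIso f := by
  rw [NatTrans.isIso_iff_isIso_app]
  intro r
  have : ∀ k, IsIso ((f.app r).f k) := fun k =>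
    inferInstanceAs (IsIso (((cochains k).map f).app r))
  exact HomologicalComplex.Hom.isIso_of_components _

theorem mono_of_isInjective {A B : PCh} {f : A ⟶ B} (hf : IsInjective f) : Mono f := by
  have : ∀ r, Mono (f.app r) := fun r => by
    have : ∀ k, Mono ((f.app r).f k) := fun k =>
      (ModuleCat.mono_iff_injective _).2 (hf r k)
    exact HomologicalComplex.mono_of_mono_f _ this
  exact NatTrans.mono_of_mono_app f

/-- The cell attachment defined by an interval decomposition of the cokernel of an injective
map. -/
theorem isCellAttachment_of_isIntervalDecomposition {Γ : ℕ → Type} (s : ∀ k, Γ k → ℝ≥0)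
    (t : ∀ k, Γ k → WithTop ℝ≥0) {A B : PCh} (f : A ⟶ B) [Mono f]
    (b : ∀ k (γ : Γ k), (B.obj (s k γ)).X k)
    (hd : ∀ k γ, ((cokernel.π f).app (s k γ)).f (k + 1)
      ((B.obj (s k γ)).d k (k + 1) (b k γ)) = 0)
    (hb : ∀ k, IsIntervalDecomposition (s k) (t k) (cokernel ((cochains k).map f))
      fun γ => (cokernel.π ((cochains k).map f)).app (s k γ) (b k γ)) :
    IsCellAttachment s t f b := by
  -- Cokernels of persistent complexes are computed degreewise, so the decompositions describe the
  -- cokernel of `f` itself.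
  have hb' : ∀ k, IsIntervalDecomposition (s k) (t k) ((cochains k).obj (cokernel f))
      fun γ => ((cokernel.π f).app (s k γ)).f k (b k γ) := fun k =>
    (hb k).of_iso (PreservesCokernel.iso (cochains k) f).symm fun γ => by
      have := PreservesCokernel.π_iso_hom (cochains k) f
      rw [← Iso.eq_comp_inv] at this
      exact (ConcreteCategory.congr_hom (congrArg (fun f => f.app (s k γ)) this) (b k γ)).symm
  have hzero : ∀ γ : Σ k, Γ k, (sphereToDisk (γ.1 + 1) (s γ.1 γ.2) (t γ.1 γ.2) ≫
      persistentDisk.desc (b γ.1 γ.2)) ≫ cokernel.π f = 0 := by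
    rintro ⟨k, γ⟩
    refine NatTrans.ext (funext fun r => HomologicalComplex.hom_ext _ _ fun j => ?_)
    apply intervalSphere.X_hom_ext
    by_cases hs : sphereSupport (k + 1) (s k γ) (t k γ) r j
    · have hdisk : diskSupport (k + 1) (s k γ) r j := ⟨hs.1, by omega, by
        rcases hs.2 with h | h
        · exact Or.inl h.2
        · exact h.2.2⟩
      have h1 := (congrArg ((persistentDisk.desc (b k γ)).app r |>.f j)
        (sphereToDisk_one hs)).trans (persistentDisk.desc_one (b k γ) hdisk)
      refine (congrArg ((cokernel.π f).app r |>.f j) h1).trans ?_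
      change ((cokernel.π f).app r).f j (diskElement (b k γ) r j) = 0
      -- In degree `k + 1`, before or after `t`, the sphere hits a coboundary of `b`, which is zero
      -- in the cokernel by `hd`. In degree `k` it is present only from `t` on, when the class of
      -- `b` is already dead.
      obtain ⟨hr, ⟨-, rfl⟩ | ⟨ht, -, rfl | hj⟩⟩ := hs
      · rw [diskElement_succ _ hr, ← PCh.map_f_d, PCh.app_f_map_f, hd, map_zero]
      · rw [diskElement_succ _ hr, ← PCh.map_f_d, PCh.app_f_map_f, hd, map_zero]
      · obtain rfl : j = k := by omega
        rw [diskElement_self _ hr, PCh.app_f_map_f]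
        exact (hb' j).map_eq_zero γ hr ht
    · rw [intervalSphere.one_eq_zero hs, map_zero, map_zero]
  let φ : (∐ fun γ : Σ k, Γ k => intervalSphere (γ.1 + 1) (s γ.1 γ.2) (t γ.1 γ.2)) ⟶ A :=
    Sigma.desc fun γ => Abelian.monoLift f _ (hzero γ)
  let ψ : (∐ fun γ : Σ k, Γ k => persistentDisk (γ.1 + 1) (s γ.1 γ.2)) ⟶ B :=
    Sigma.desc fun γ => persistentDisk.desc (b γ.1 γ.2)
  let m := Limits.Sigma.map fun γ : Σ k, Γ k =>
    sphereToDisk (γ.1 + 1) (s γ.1 γ.2) (t γ.1 γ.2)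
  have w : m ≫ ψ = φ ≫ f := by
    ext γ : 1
    simp [m, φ, ψ]
  have hgen : ∀ k (γ : Γ k), ((Sigma.ι (fun γ : Σ k, Γ k =>
      persistentDisk (γ.1 + 1) (s γ.1 γ.2)) ⟨k, γ⟩ ≫ ψ).app
        (s k γ)).f k (persistentDisk.gen k (s k γ)) = b k γ := by
    intro k γ
    have : Sigma.ι (fun γ : Σ k, Γ k => persistentDisk (γ.1 + 1) (s γ.1 γ.2)) ⟨k, γ⟩ ≫ ψ =
      persistentDisk.desc (b k γ) := by simp [ψ]
    rw [this, persistentDisk.desc_gen]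
  refine ⟨φ, ψ, isPushout_of_isIso_cokernel_map w ?_, hgen⟩
  refine isIso_of_isIso_cochains _ fun k => ?_
  set c := cokernel.map m f φ ψ w
  set p := (cochains k).map (cokernel.π m)
  have hp : Epi p := inferInstance
  have hmp : (cochains k).map m ≫ p = 0 := by
    rw [← Functor.map_comp, cokernel.condition, Functor.map_zero]
  let ι := fun γ : Σ k, Γ k =>
    (cochains k).map (Sigma.ι (fun γ : Σ k, Γ k => persistentDisk (γ.1 + 1) (s γ.1 γ.2)) γ)
  have hι : ∀ γ : Σ k, Γ k, (cochains k).map (sphereToDisk (γ.1 + 1) (s γ.1 γ.2) (t γ.1 γ.2)) ≫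
      ι γ ≫ p = 0 := by
    intro γ
    rw [← Category.assoc, ← Functor.map_comp]
    have : sphereToDisk (γ.1 + 1) (s γ.1 γ.2) (t γ.1 γ.2) ≫
        Sigma.ι (fun γ : Σ k, Γ k => persistentDisk (γ.1 + 1) (s γ.1 γ.2)) γ =
        Sigma.ι (fun γ : Σ k, Γ k => intervalSphere (γ.1 + 1) (s γ.1 γ.2) (t γ.1 γ.2)) γ ≫ m := by
      simp [m]
    rw [this, Functor.map_comp, Category.assoc, hmp, comp_zero]
  have hpc : p ≫ (cochains k).map c = (cochains k).map ψ ≫ (cochains k).map (cokernel.π f) := by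
    rw [← Functor.map_comp, ← Functor.map_comp]
    simp [c]
  have hqgen : ∀ γ : Γ k, (ι ⟨k, γ⟩ ≫ p ≫ (cochains k).map c).app (s k γ)
      (persistentDisk.gen k (s k γ)) = ((cokernel.π f).app (s k γ)).f k (b k γ) := by
    intro γ
    rw [hpc, ← hgen k γ]
    rfl
  -- The inverse `G` of the comparison sends the interval generated by `b k γ` to the class of the
  -- generator of the disk `γ` in the cokernel of `m`.
  choose g hg using fun γ : Γ k =>
    persistentDisk.exists_intervalModule_desc (ι ⟨k, γ⟩ ≫ p) (hι ⟨k, γ⟩) ((hb k).1 γ)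
  obtain ⟨G, hG⟩ := (hb' k).exists_desc g
  refine ⟨G, ?_, ?_⟩
  · rw [← cancel_epi p]
    refine Cofan.IsColimit.hom_ext (isColimitOfHasCoproductOfPreservesColimit (cochains k)
      (fun γ : Σ k, Γ k => persistentDisk (γ.1 + 1) (s γ.1 γ.2))) _ _ ?_
    rintro ⟨l, γ⟩
    change ι ⟨l, γ⟩ ≫ p ≫ (cochains k).map c ≫ G = ι ⟨l, γ⟩ ≫ p ≫ 𝟙 _
    rw [Category.comp_id]
    -- A disk is determined by its generator in the lower degree `l`, is killed by `p` in degree `l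
    -- + 1`, and is zero in all other degrees.
    by_cases h₁ : k = l
    · subst h₁
      apply persistentDisk.cochains_hom_ext
      refine Eq.trans ?_ (hg γ)
      rw [← hG]
      exact congrArg (G.app (s k γ)) (hqgen γ)
    · by_cases h₂ : k = l + 1
      · subst h₂
        rw [← cancel_epi ((cochains (l + 1)).map (sphereToDisk (l + 1) (s l γ) (t l γ))),
          hι ⟨l, γ⟩]
        have := hι ⟨l, γ⟩ =≫ ((cochains (l + 1)).map c ≫ G)
        simpa only [Category.assoc, zero_comp] using this
      · exact persistentDisk.cochains_eq h₁ h₂ _ _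
  · apply (hb' k).hom_ext
    intro γ
    exact (congrArg (((cochains k).map c).app (s k γ)) ((hG γ).trans (hg γ))).trans (hqgen γ)

/-! ### Cokernels of persistence modules -/

section Cokernels

variable {V V' : PVec} (f : V ⟶ V')

theorem cokernel_π_app_surjective (r : ℝ≥0) : Function.Surjective ((cokernel.π f).app r) :=
  (ModuleCat.epi_iff_surjective _).1
    (inferInstanceAs (Epi (((evaluation _ _).obj r).map (cokernel.π f))))

theorem cokernel_π_app_map (r : ℝ≥0) (x : V.obj r) : (cokernel.π f).app r (f.app r x) = 0 :=
  ConcreteCategory.congr_hom (congrArg (fun g => g.app r) (cokernel.condition f)) x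

theorem cokernel_π_app_eq_zero_iff (r : ℝ≥0) (x : V'.obj r) :
    (cokernel.π f).app r x = 0 ↔ ∃ y, f.app r y = x := by
  constructor
  · intro hx
    have hS : (ShortComplex.mk f (cokernel.π f) (cokernel.condition f)).Exact :=
      ShortComplex.exact_of_g_is_cokernel _ (cokernelIsCokernel f)
    have := (ShortComplex.moduleCat_exact_iff _).1 (hS.map ((evaluation _ _).obj r))
    exact this x hx
  · rintro ⟨y, rfl⟩
    exact cokernel_π_app_map f r y

/-- Between jumps the structure maps form an isomorphism of maps, so they induce an isomorphism of
cokernels. -/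
theorem jumpsIn_cokernel {T : Finset ℝ≥0} (hV : JumpsIn V T) (hV' : JumpsIn V' T) :
    JumpsIn (cokernel f) T := by
  intro a b h hab
  have hnat : ∀ x, (cokernel f).map (homOfLE h) ((cokernel.π f).app a x) =
      (cokernel.π f).app b (V'.map (homOfLE h) x) := fun x =>
    (NatTrans.naturality_apply (cokernel.π f) (homOfLE h) x).symm
  constructor
  · refine (injective_iff_map_eq_zero _).2 fun x hx => ?_
    obtain ⟨x, rfl⟩ := cokernel_π_app_surjective f a x
    rw [hnat, cokernel_π_app_eq_zero_iff] at hx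
    obtain ⟨y, hy⟩ := hx
    obtain ⟨y, rfl⟩ := (hV a b h hab).2 y
    rw [NatTrans.naturality_apply] at hy
    rw [← (hV' a b h hab).1 hy, cokernel_π_app_map]
  · intro y
    obtain ⟨y, rfl⟩ := cokernel_π_app_surjective f b y
    obtain ⟨x, rfl⟩ := (hV' a b h hab).2 y
    exact ⟨_, hnat x⟩

/-- The cokernel of a map of persistence modules with finitely many jumps has an interval
decomposition whose generators are the classes of given elements. -/
theorem exists_isIntervalDecomposition_cokernel {T : Finset ℝ≥0} (hT : 0 ∈ T) (hV : JumpsIn V T)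
    (hV' : JumpsIn V' T) :
    ∃ (Γ : Type) (s : Γ → ℝ≥0) (t : Γ → WithTop ℝ≥0) (v : ∀ γ, V'.obj (s γ)),
      IsIntervalDecomposition s t (cokernel f) fun γ => (cokernel.π f).app (s γ) (v γ) := by
  obtain ⟨Γ, s, t, v, hv⟩ := exists_isBarcode T _ (jumpsIn_cokernel f hV hV')
    -- No time precedes `0`, so having `0` among the jump times makes the initial vanishing
    -- condition vacuous.
    fun r hr => absurd (hr 0 hT) (not_lt.2 zero_le)
  choose v' hv' using fun γ => cokernel_π_app_surjective f (s γ) (v γ)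
  refine ⟨Γ, s, t, v', ?_⟩
  simp_rw [hv']
  exact hv.isIntervalDecomposition

end Cokernels

/-! ### Jumps of tame objects -/

theorem JumpsIn.mono {V : PVec} {T T' : Finset ℝ≥0} (h : JumpsIn V T) (hT : T ⊆ T') :
    JumpsIn V T' := fun a b hab hT' => h a b hab fun t ht => hT' t (hT ht)

theorem IsTame.exists_finset {C : Type*} [Category* C] {X : Persistent C} (hX : IsTame X) :
    ∃ T : Finset ℝ≥0, ∀ (a b : ℝ≥0) (h : a ≤ b), (∀ t ∈ T, a < t → b < t) →
      IsIso (X.map (homOfLE h)) := by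
  obtain ⟨n, t, -, ht⟩ := hX
  refine ⟨Finset.univ.image t, fun a b h hab => ?_⟩
  rcases h.eq_or_lt with rfl | hlt
  · exact inferInstanceAs (IsIso (X.map (𝟙 a)))
  · by_contra hX
    obtain ⟨i, hi, hi'⟩ := ht a b hlt hX
    exact absurd (hab (t i) (by simp) hi) (not_lt.2 hi')

theorem IsTame.exists_jumpsIn {X : PCh} (hX : IsTame X) :
    ∃ T : Finset ℝ≥0, ∀ k, JumpsIn ((cochains k).obj X) T ∧ JumpsIn ((cocycles k).obj X) T := by
  obtain ⟨T, hT⟩ := hX.exists_finset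
  refine ⟨T, fun k => ⟨fun a b h hab => ?_, fun a b h hab => ?_⟩⟩
  · have := hT a b h hab
    exact (ConcreteCategory.isIso_iff_bijective _).1
      (inferInstanceAs (IsIso ((HomologicalComplex.eval _ _ k).map (X.map (homOfLE h)))))
  · have := hT a b h hab
    exact (ConcreteCategory.isIso_iff_bijective _).1
      (inferInstanceAs (IsIso
        ((HomologicalComplex.cyclesFunctor _ _ k).map (X.map (homOfLE h)))))

/-! ### Cocycles -/

theorem iCycles_injective (K : CochainComplex (ModuleCat.{0} ℚ) ℕ) (k : ℕ) :
    Function.Injective (K.iCycles k) :=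
  (ModuleCat.mono_iff_injective _).1 inferInstance

theorem d_iCycles_apply (K : CochainComplex (ModuleCat.{0} ℚ) ℕ) (k l : ℕ) (z : K.cycles k) :
    K.d k l (K.iCycles k z) = 0 :=
  ConcreteCategory.congr_hom (K.iCycles_d k l) z

theorem exists_iCycles_eq (K : CochainComplex (ModuleCat.{0} ℚ) ℕ) (k : ℕ) (x : K.X k)
    (hx : K.d k (k + 1) x = 0) : ∃ z, K.iCycles k z = x := by
  -- The element is regarded as a map from `ℚ`, to which the universal property of the cycles
  -- applies.
  let g : ModuleCat.of ℚ ℚ ⟶ K.X k := ModuleCat.ofHom (LinearMap.toSpanSingleton ℚ _ x)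
  have hg : g ≫ K.d k (k + 1) = 0 := by
    apply ModuleCat.hom_ext
    apply LinearMap.ext_ring
    change K.d k (k + 1) ((1 : ℚ) • x) = 0
    rw [one_smul, hx]
  refine ⟨K.liftCycles g (k + 1) (by simp) hg (1 : ℚ), ?_⟩
  refine (ConcreteCategory.congr_hom (K.liftCycles_i g (k + 1) (by simp) hg) (1 : ℚ)).trans ?_
  exact one_smul ℚ x

/-! ### Subcomplexes -/

section Subcomplexes

variable {Y : PCh} (S : ∀ r k, Submodule ℚ ((Y.obj r).X k))

/-- The subcomplex of `Y` consisting of the given submodules. -/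
def subcomplex (hd : ∀ r i j, S r i ≤ (S r j).comap ((Y.obj r).d i j).hom)
    (hm : ∀ a b (φ : a ⟶ b) k, S a k ≤ (S b k).comap ((Y.map φ).f k).hom) : PCh where
  obj r :=
    { X := fun k => ModuleCat.of ℚ (S r k)
      d := fun i j => ModuleCat.ofHom (((Y.obj r).d i j).hom.restrict (hd r i j))
      shape := fun i j h => by
        ext x
        exact ConcreteCategory.congr_hom ((Y.obj r).shape i j h) x.1
      d_comp_d' := fun i j l _ _ => by
        ext x
        exact PCh.d_d r i j l x.1 }
  map {a b} φ :=
    { f := fun k => ModuleCat.ofHom (((Y.map φ).f k).hom.restrict (hm a b φ k))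
      comm' := fun i j _ => by
        ext x
        exact (PCh.map_f_d φ i j x.1).symm }
  map_id r := by
    ext k x
    exact ConcreteCategory.congr_hom (((cochains k).obj Y).map_id r) x.1
  map_comp f g := by
    ext k x
    exact ConcreteCategory.congr_hom (((cochains k).obj Y).map_comp f g) x.1

variable (hd : ∀ r i j, S r i ≤ (S r j).comap ((Y.obj r).d i j).hom)
  (hm : ∀ a b (φ : a ⟶ b) k, S a k ≤ (S b k).comap ((Y.map φ).f k).hom)

/-- The inclusion of a subcomplex. -/
def subcomplex.ι : subcomplex S hd hm ⟶ Y where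
  app r :=
    { f := fun k => ModuleCat.ofHom (S r k).subtype
      comm' := fun _ _ _ => rfl }
  naturality _ _ _ := rfl

/-- The lift to a subcomplex of a map whose image it contains. -/
def subcomplex.lift {X : PCh} (i : X ⟶ Y) (h : ∀ r k x, (i.app r).f k x ∈ S r k) :
    X ⟶ subcomplex S hd hm where
  app r :=
    { f := fun k => ModuleCat.ofHom (((i.app r).f k).hom.codRestrict (S r k) (h r k))
      comm' := fun k l _ => by
        ext x
        apply Subtype.ext
        exact ConcreteCategory.congr_hom ((i.app r).comm k l) x }
  naturality a b φ := by
    ext k x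
    apply Subtype.ext
    exact PCh.app_f_map_f i φ k x

end Subcomplexes

/-! ### The subcomplex generated by an image and all cocycles -/

theorem PCh.app_f_d {A B : PCh} (f : A ⟶ B) (r : ℝ≥0) (i j : ℕ) (x : (A.obj r).X i) :
    (f.app r).f j ((A.obj r).d i j x) = (B.obj r).d i j ((f.app r).f i x) :=
  (ConcreteCategory.congr_hom ((f.app r).comm i j) x).symm

theorem exists_isImageAddCocycles {X Y : PCh} (i : X ⟶ Y) :
    ∃ (W : PCh) (a : X ⟶ W) (j : W ⟶ Y), a ≫ j = i ∧ IsImageAddCocycles i j := by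
  let S : ∀ r k, Submodule ℚ ((Y.obj r).X k) := fun r k =>
    LinearMap.range ((i.app r).f k).hom ⊔ LinearMap.ker ((Y.obj r).d k (k + 1)).hom
  have hd : ∀ r k l, S r k ≤ (S r l).comap ((Y.obj r).d k l).hom := by
    intro r k l
    refine sup_le ?_ ?_
    · rintro _ ⟨x, rfl⟩
      exact Submodule.mem_sup_left ⟨(X.obj r).d k l x, PCh.app_f_d i r k l x⟩
    · intro z hz
      have : (Y.obj r).d k l z = 0 := by
        by_cases h : k + 1 = l
        · subst h
          exact hz
        · exact ConcreteCategory.congr_hom ((Y.obj r).shape k l h) z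
      change (Y.obj r).d k l z ∈ S r l
      rw [this]
      exact Submodule.zero_mem _
  have hm : ∀ a b (φ : a ⟶ b) k, S a k ≤ (S b k).comap ((Y.map φ).f k).hom := by
    intro a b φ k
    refine sup_le ?_ ?_
    · rintro _ ⟨x, rfl⟩
      exact Submodule.mem_sup_left ⟨(X.map φ).f k x, PCh.app_f_map_f i φ k x⟩
    · intro z hz
      refine Submodule.mem_sup_right ?_
      have hz : (Y.obj a).d k (k + 1) z = 0 := hz
      change (Y.obj b).d k (k + 1) ((Y.map φ).f k z) = 0
      rw [← PCh.map_f_d, hz, map_zero]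
  exact ⟨subcomplex S hd hm,
    subcomplex.lift S hd hm i fun r k x => Submodule.mem_sup_left ⟨x, rfl⟩,
    subcomplex.ι S hd hm, rfl, fun r k => Subtype.val_injective,
    fun r k => Submodule.range_subtype (S r k)⟩

section ImageAddCocycles

variable {X W Y : PCh} {i : X ⟶ Y} {j : W ⟶ Y}

theorem IsImageAddCocycles.exists_preimage (h : IsImageAddCocycles i j) {r : ℝ≥0} {k : ℕ}
    {y : (Y.obj r).X k} (hy : (Y.obj r).d k (k + 1) y = 0) : ∃ w, (j.app r).f k w = y := by
  have : y ∈ LinearMap.range ((j.app r).f k).hom := by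
    rw [h.2 r k]
    exact Submodule.mem_sup_right hy
  exact this

theorem IsImageAddCocycles.exists_eq_add (h : IsImageAddCocycles i j) {r : ℝ≥0} {k : ℕ}
    (w : (W.obj r).X k) : ∃ x z, (Y.obj r).d k (k + 1) z = 0 ∧
      (j.app r).f k w = (i.app r).f k x + z := by
  have : (j.app r).f k w ∈ LinearMap.range ((i.app r).f k).hom ⊔
      LinearMap.ker ((Y.obj r).d k (k + 1)).hom := by
    rw [← h.2 r k]
    exact ⟨w, rfl⟩
  obtain ⟨_, ⟨x, rfl⟩, z, hz, hxz⟩ := Submodule.mem_sup.1 this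
  exact ⟨x, z, hz, hxz.symm⟩

theorem IsImageAddCocycles.jumpsIn (h : IsImageAddCocycles i j) {T : Finset ℝ≥0}
    (hX : ∀ k, JumpsIn ((cochains k).obj X) T) (hY : ∀ k, JumpsIn ((cochains k).obj Y) T)
    (k : ℕ) : JumpsIn ((cochains k).obj W) T := by
  intro a b hab hT
  have hYinj : ∀ l, Function.Injective ((Y.map (homOfLE hab)).f l) := fun l => (hY l a b hab hT).1
  constructor
  · intro (w : (W.obj a).X k) (w' : (W.obj a).X k) hw
    have hw : (W.map (homOfLE hab)).f k w = (W.map (homOfLE hab)).f k w' := hw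
    apply h.1 a k
    apply hYinj k
    rw [← PCh.app_f_map_f, ← PCh.app_f_map_f, hw]
  · intro w
    obtain ⟨x, z, hz, hw⟩ := h.exists_eq_add (r := b) (k := k) w
    obtain ⟨x, rfl⟩ : ∃ x', (X.map (homOfLE hab)).f k x' = x := (hX k a b hab hT).2 x
    obtain ⟨z, rfl⟩ : ∃ z', (Y.map (homOfLE hab)).f k z' = z := (hY k a b hab hT).2 z
    -- The preimage at time `a` of a cocycle is again a cocycle because the structure map of `Y` is
    -- injective in degree `k + 1` too.
    have hz' : (Y.obj a).d k (k + 1) z = 0 := by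
      apply hYinj (k + 1)
      rw [PCh.map_f_d, hz, map_zero]
    have hmem : (i.app a).f k x + z ∈ LinearMap.range ((j.app a).f k).hom := by
      rw [h.2 a k]
      exact Submodule.add_mem_sup ⟨x, rfl⟩ hz'
    obtain ⟨w', hw'⟩ := hmem
    refine ⟨w', h.1 b k ?_⟩
    rw [hw]
    refine (PCh.app_f_map_f j (homOfLE hab) k w').trans ?_
    refine (congrArg ((Y.map (homOfLE hab)).f k) hw').trans ?_
    rw [map_add, PCh.app_f_map_f]

/-- The inclusion of the cocycles of `Y` into `i(X) + ZY`. -/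
theorem IsImageAddCocycles.exists_cocycles_lift (h : IsImageAddCocycles i j) (k : ℕ) :
    ∃ κ : (cocycles k).obj Y ⟶ (cochains k).obj W,
      ∀ r z, (j.app r).f k (κ.app r z) = (Y.obj r).iCycles k z := by
  let ι : (cocycles k).obj Y ⟶ (cochains k).obj Y :=
    { app := fun r => (Y.obj r).iCycles k
      naturality := fun a b φ => HomologicalComplex.cyclesMap_i (Y.map φ) k }
  have hmono : Mono ((cochains k).map j) := by
    have : ∀ r, Mono (((cochains k).map j).app r) := fun r =>
      (ModuleCat.mono_iff_injective _).2 (h.1 r k)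
    exact NatTrans.mono_of_mono_app _
  have hι : ι ≫ cokernel.π ((cochains k).map j) = 0 := by
    ext r z
    refine (cokernel_π_app_eq_zero_iff _ r _).2 ?_
    exact h.exists_preimage (d_iCycles_apply (Y.obj r) k (k + 1) z)
  refine ⟨Abelian.monoLift ((cochains k).map j) ι hι, fun r z => ?_⟩
  exact ConcreteCategory.congr_hom
    (congrArg (fun f => f.app r) (Abelian.monoLift_comp ((cochains k).map j) ι hι)) z

theorem iCycles_cocycles_map (i : X ⟶ Y) (k : ℕ) (r : ℝ≥0) (z : ((cocycles k).obj X).obj r) :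
    (Y.obj r).iCycles k (((cocycles k).map i).app r z) =
      (i.app r).f k ((X.obj r).iCycles k z) :=
  ConcreteCategory.congr_hom (HomologicalComplex.cyclesMap_i (i.app r) k) z

/-- The inclusion of the cocycles of `Y` into `W = i(X) + ZY` induces an isomorphism from
`ZY / i(ZX)` to `W / i(X)`. -/
theorem IsImageAddCocycles.exists_cokernel_iso (h : IsImageAddCocycles i j) (hi : IsInjective i)
    {a : X ⟶ W} (ha : a ≫ j = i) (k : ℕ) {κ : (cocycles k).obj Y ⟶ (cochains k).obj W}
    (hκ : ∀ r z, (j.app r).f k (κ.app r z) = (Y.obj r).iCycles k z) :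
    ∃ e : cokernel ((cocycles k).map i) ≅ cokernel ((cochains k).map a),
      cokernel.π _ ≫ e.hom = κ ≫ cokernel.π _ := by
  have hja : ∀ r l x, (j.app r).f l ((a.app r).f l x) = (i.app r).f l x := by
    intro r l x
    rw [← ha]
    rfl
  have hzero : (cocycles k).map i ≫ κ ≫ cokernel.π ((cochains k).map a) = 0 := by
    ext r z
    refine (cokernel_π_app_eq_zero_iff _ r _).2 ⟨(X.obj r).iCycles k z, h.1 r k ?_⟩
    exact (hja r k _).trans ((iCycles_cocycles_map i k r z).symm.trans (hκ r _).symm)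
  let c := cokernel.desc _ _ hzero
  have hc : cokernel.π _ ≫ c = κ ≫ cokernel.π ((cochains k).map a) := cokernel.π_desc _ _ _
  have hcapp : ∀ r z, c.app r ((cokernel.π ((cocycles k).map i)).app r z) =
      (cokernel.π ((cochains k).map a)).app r (κ.app r z) := fun r z =>
    ConcreteCategory.congr_hom (congrArg (fun f => f.app r) hc) z
  have : IsIso c := by
    rw [NatTrans.isIso_iff_isIso_app]
    intro r
    rw [ConcreteCategory.isIso_iff_bijective]
    constructor
    · refine (injective_iff_map_eq_zero _).2 fun z hz => ?_
      obtain ⟨z, rfl⟩ := cokernel_π_app_surjective _ r z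
      rw [hcapp] at hz
      obtain ⟨x, hx⟩ : ∃ x : (X.obj r).X k, (a.app r).f k x = κ.app r z :=
        (cokernel_π_app_eq_zero_iff _ r _).1 hz
      have hix : (i.app r).f k x = (Y.obj r).iCycles k z := by
        rw [← hja, hx, hκ]
      -- Here injectivity of `i` enters: `x` has a cocycle as image, so it is a cocycle, and `z`
      -- comes from `ZX`.
      have hdx : (X.obj r).d k (k + 1) x = 0 := by
        apply hi r (k + 1)
        rw [PCh.app_f_d, hix, map_zero]
        exact d_iCycles_apply _ _ _ _
      obtain ⟨x, rfl⟩ := exists_iCycles_eq _ _ _ hdx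
      refine (cokernel_π_app_eq_zero_iff _ r _).2 ⟨x, iCycles_injective _ _ ?_⟩
      rw [← hix]
      exact iCycles_cocycles_map i k r x
    · intro w
      obtain ⟨w, rfl⟩ := cokernel_π_app_surjective _ r w
      obtain ⟨x, z, hz, hw⟩ := h.exists_eq_add (r := r) (k := k) w
      obtain ⟨z, rfl⟩ : ∃ z' : ((cocycles k).obj Y).obj r, (Y.obj r).iCycles k z' = z :=
        exists_iCycles_eq _ _ _ hz
      let u : (W.obj r).X k := κ.app r z
      have hu : (j.app r).f k u = (Y.obj r).iCycles k z := hκ r z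
      -- Modulo the image of `X`, every element of `W` is a cocycle of `Y`.
      have hw' : w = (a.app r).f k x + u := h.1 r k (by rw [hw, map_add, hja, hu])
      refine ⟨(cokernel.π ((cocycles k).map i)).app r z, (hcapp r z).trans ?_⟩
      have hπ := (cokernel.π ((cochains k).map a)).app r |>.hom.map_add ((a.app r).f k x) u
      refine ((congrArg ((cokernel.π ((cochains k).map a)).app r) hw').trans (hπ.trans ?_)).symm
      exact (congrArg (· + _) (cokernel_π_app_map ((cochains k).map a) r x)).trans (zero_add _)
  exact ⟨asIso c, hc⟩

end ImageAddCocycles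

/-! ### The main results -/

/-- Left lifting classes are stable under coproducts and pushouts. The condition `s < t` places each
cell among the generating cofibrations. -/
theorem IsCellAttachment.cofibration {Γ : ℕ → Type} {s : ∀ k, Γ k → ℝ≥0}
    {t : ∀ k, Γ k → WithTop ℝ≥0} {A B : PCh} {f : A ⟶ B}
    {b : ∀ k (γ : Γ k), (B.obj (s k γ)).X k} (h : IsCellAttachment s t f b)
    (hst : ∀ k γ, (s k γ : WithTop ℝ≥0) < t k γ) : generatingCofibrations.rlp.llp f := by
  obtain ⟨φ, ψ, hpush, -⟩ := h
  refine MorphismProperty.of_isPushout hpush (MorphismProperty.colimMap _ ?_)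
  rintro ⟨γ⟩
  exact MorphismProperty.le_llp_rlp _ _ (generatingCofibrations.sphereToDisk _ _ _ (hst _ _))

theorem cokernel_π_app_f_eq_zero {A B : PCh} (f : A ⟶ B) (r : ℝ≥0) (k : ℕ) (x : (A.obj r).X k) :
    ((cokernel.π f).app r).f k ((f.app r).f k x) = 0 :=
  ConcreteCategory.congr_hom
    (congrArg (fun g => (g.app r).f k) (cokernel.condition f)) x

theorem cofibration_and_isTwoStepCellAttachment {X Y : PCh} (i : X ⟶ Y) (hX : IsTame X)
    (hY : IsTame Y) (hi : IsInjective i) : Cofibration i ∧ IsTwoStepCellAttachment i := by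
  obtain ⟨TX, hTX⟩ := hX.exists_jumpsIn
  obtain ⟨TY, hTY⟩ := hY.exists_jumpsIn
  let T := insert 0 (TX ∪ TY)
  have hT : 0 ∈ T := Finset.mem_insert_self _ _
  have hTXT : TX ⊆ T := Finset.subset_union_left.trans (Finset.subset_insert _ _)
  have hTYT : TY ⊆ T := Finset.subset_union_right.trans (Finset.subset_insert _ _)
  obtain ⟨W, a, j, rfl, hj⟩ := exists_isImageAddCocycles i
  have ha : IsInjective a := fun r k => Function.Injective.of_comp (f := (j.app r).f k) (hi r k)
  have := mono_of_isInjective ha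
  have := mono_of_isInjective hj.1
  have hWT := hj.jumpsIn (fun k => (hTX k).1.mono hTXT) (fun k => (hTY k).1.mono hTYT)
  choose Γ s t z hz using fun k => exists_isIntervalDecomposition_cokernel
    ((cocycles k).map (a ≫ j)) hT ((hTX k).2.mono hTXT) ((hTY k).2.mono hTYT)
  choose Δ s' t' y hy using fun k => exists_isIntervalDecomposition_cokernel
    ((cochains k).map j) hT (hWT k) ((hTY k).1.mono hTYT)
  choose κ hκ using hj.exists_cocycles_lift
  let w : ∀ k (γ : Γ k), (W.obj (s k γ)).X k := fun k γ => (κ k).app (s k γ) (z k γ)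
  have hcell₁ : IsCellAttachment s t a w := by
    refine isCellAttachment_of_isIntervalDecomposition s t a w (fun k γ => ?_) fun k => ?_
    · have : (W.obj (s k γ)).d k (k + 1) (w k γ) = 0 := by
        apply hj.1
        rw [PCh.app_f_d, hκ, map_zero]
        exact d_iCycles_apply _ _ _ _
      rw [this, map_zero]
    · obtain ⟨e, he⟩ := hj.exists_cokernel_iso hi rfl k (hκ k)
      exact (hz k).of_iso e fun γ =>
        ConcreteCategory.congr_hom (congrArg (fun f => f.app (s k γ)) he) (z k γ)
  have hcell₂ : IsCellAttachment s' t' j y := by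
    refine isCellAttachment_of_isIntervalDecomposition s' t' j y (fun k γ => ?_) hy
    -- The coboundary of `y k γ` is a cocycle, so it lies in `W`; this is why all cocycles were
    -- added first.
    obtain ⟨x, hx⟩ := hj.exists_preimage (PCh.d_d (s' k γ) k (k + 1) (k + 1 + 1) (y k γ))
    rw [← hx, cokernel_π_app_f_eq_zero]
  refine ⟨?_, W, a, j, rfl, hj, ⟨Γ, s, t, z, w, fun k γ => hκ k _ _, hz, hcell₁⟩,
    ⟨Δ, s', t', y, hy, hcell₂⟩⟩
  rw [cofibration_iff]
  exact MorphismProperty.comp_mem generatingCofibrations.rlp.llp _ _ (hcell₁.cofibration fun k => (hz k).1)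
    (hcell₂.cofibration fun k => (hy k).1)

theorem isTame_of_isZero {X : PCh} (hX : IsZero X) : IsTame X := by
  refine ⟨0, fun _ => 0, Subsingleton.strictMono (α := Fin 1) _, fun a b h hiso => absurd ?_ hiso⟩
  have h0 : ∀ r, IsZero (X.obj r) := fun r => (Functor.isZero_iff X).1 hX r
  exact ⟨0, (h0 a).eq_of_src _ _, (h0 b).eq_of_src _ _⟩

theorem isInjective_of_isZero {X Y : PCh} (i : X ⟶ Y) (hX : IsZero X) : IsInjective i := by
  intro r k
  have h0 : IsZero ((X.obj r).X k) :=
    (HomologicalComplex.eval _ _ k).map_isZero ((Functor.isZero_iff X).1 hX r)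
  have := ModuleCat.isZero_iff_subsingleton.1 h0
  exact Function.injective_of_subsingleton _

end PersistentComplex

end

theorem mainTheorem4 :
    (∀ (X Y : PersistentComplex.PCh) (i : X ⟶ Y),
      PersistentComplex.IsTame X → PersistentComplex.IsTame Y →
      PersistentComplex.IsInjective i →
      Cofibration i ∧ PersistentComplex.IsTwoStepCellAttachment i) ∧
    (∀ X : PersistentComplex.PCh, PersistentComplex.IsTame X → IsCofibrant X) := by
  refine ⟨fun X Y i => PersistentComplex.cofibration_and_isTwoStepCellAttachment i,
    fun X hX => ?_⟩
  -- The initial object is zero, hence tame with an injective map to `X`; cofibrancy of `X` is then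
  -- an instance of the first part.
  have h0 : IsZero (⊥_ PersistentComplex.PCh) :=
    (isZero_zero _).of_iso (initialIsInitial.uniqueUpToIso (isZero_zero _).isInitial)
  exact (PersistentComplex.cofibration_and_isTwoStepCellAttachment (initial.to X)
    (PersistentComplex.isTame_of_isZero h0) hX
    (PersistentComplex.isInjective_of_isZero _ h0)).1
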